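/- Let $\mathcal X,\mathcal K$ be real Hilbert spaces and let $\Gamma_0(\mathcal H)$ denote the set of proper lower semicontinuous convex functions $\mathcal H\to(-\infty,\infty]$. Let $f\in\Gamma_0(\mathcal X)$, $g\in\Gamma_0(\mathcal K)$ and let $A:\mathcal X\to\mathcal K$ be a bounded linear operator with adjoint $A^*$. Write $\operatorname{dom} h=\{h<\infty\}$, $\operatorname{prox}_h(x)=\operatorname{argmin}_y\,(h(y)+\frac12\|y-x\|^2)$ for $h \in \Gamma_0$, $\operatorname{Fix}(T)=\{z: Tz=z\}$, and, for a convex set $C$, $\operatorname{sri}(C)=\{x\in C:\ \{t(y-x): t>0,\ y\in C\}=\overline{\operatorname{span}}(C-x)\}$. Assume that $\mathcal S_p:=\operatorname{argmin}_{x\in\mathcal X}\,(f(x)+g(Ax))\neq\varnothing$ and $0\in\operatorname{sri}(\operatorname{dom} g-A\operatorname{dom} f)$. Let $\Psi\in\Gamma_0(\mathcal X)$ be real-valued and G\^ateaux differentiable on $\mathcal X$ with Lipschitz continuous gradient $\nabla\Psi$, and assume that $\Omega:=\operatorname{argmin}_{x\in\mathcal S_p}\Psi(x)\neq\varnothing$.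 Equip $\mathcal X\times\mathcal K$ with the inner product $\langle (x,y),(x',y')\rangle=\langle x,x'\rangle+\langle y,y'\rangle$ and define $\mathbf T:\mathcal X\times\mathcal K\to\mathcal X\times\mathcal K$, $(x,y)\mapsto(x_T,y_T)$, by $$p=x-A^*(I+AA^*)^{-1}(Ax-y),\qquad (x_{1/2},y_{1/2})=(2p-x,\,2Ap-y),$$ $$(x_T,y_T)=(2\operatorname{prox}_f(x_{1/2})-x_{1/2},\ 2\operatorname{prox}_g(y_{1/2})-y_{1/2}).$$ Let $F(x,y)=f(x)+g(y)$, let $N=\{(x,y): Ax=y\}$ with orthogonal projection $P_N$ and indicator function $\iota_N$ ($0$ on $N$, $+\infty$ elsewhere), and let $\Xi:\mathcal X\times\mathcal K\to\mathcal X$ be the bounded linear map sending $z$ to the first component of $P_N z$. Put $\Theta:=\Psi\circ\Xi$. Then: (a) $\mathbf T=(2\operatorname{prox}_F-I)\circ(2\operatorname{prox}_{\iota_N}-I)$, i.e. $\mathbf T$ is the Douglas--Rachford operator for $F+\iota_N$, and $\mathbf T$ is nonexpansive. (b) $\mathcal S_p=\Xi(\operatorname{Fix}(\mathbf T))$ and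 $\Omega=\Xi\big(\operatorname{argmin}_{z\in\operatorname{Fix}(\mathbf T)}\Theta(z)\big)$. (c) $\Theta\in\Gamma_0(\mathcal X\times\mathcal K)$ is G\^ateaux differentiable with Lipschitz continuous gradient $\nabla\Theta=\Xi^*\circ\nabla\Psi\circ\Xi$. (d) For every $\alpha\in(0,1)$ the operator $\mathbf T_\alpha:=(1-\alpha)I+\alpha\mathbf T$ is nonexpansive with $\operatorname{Fix}(\mathbf T_\alpha)=\operatorname{Fix}(\mathbf T)\ne\varnothing$, and $\|\mathbf T_\alpha z-w\|<\|z-w\|$ for all $z\notin\operatorname{Fix}(\mathbf T_\alpha)$, $w\in\operatorname{Fix}(\mathbf T_\alpha)$. (e) Let $\alpha\in(0,1)$, let $(\lambda_{n+1})_{n\ge0}$ be nonnegative reals with $\sum_n\lambda_{n+1}^2<\infty$ and $\sum_n\lambda_{n+1}=\infty$, let $(x_0,y_0)\in\mathcal X\times\mathcal K$, and define for $n\ge 0$ $$(x_{n+1/2},y_{n+1/2})=(1-\alpha)(x_n,y_n)+\alpha\mathbf T(x_n,y_n),$$ $$x^\star_{n+1}=x_{n+1/2}-A^*(I+AA^*)^{-1}(Ax_{n+1/2}-y_{n+1/2}),$$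 $$x_{n+1}=x_{n+1/2}-\lambda_{n+1}\big(I-A^*(I+AA^*)^{-1}A\big)\nabla\Psi(x^\star_{n+1}),$$ $$y_{n+1}=y_{n+1/2}-\lambda_{n+1}(I+AA^*)^{-1}A\,\nabla\Psi(x^\star_{n+1}).$$ With $z_n=(x_n,y_n)$ and $z_{n+1/2}=(x_{n+1/2},y_{n+1/2})$, this is the hybrid steepest descent method for minimizing $\Theta$ over $\operatorname{Fix}(\mathbf T_\alpha)$: $z_{n+1/2}=\mathbf T_\alpha z_n$, $z_{n+1}=z_{n+1/2}-\lambda_{n+1}\nabla\Theta(z_{n+1/2})$, and $x^\star_{n+1}=\Xi z_{n+1/2}$. Moreover, if $\dim(\mathcal X\times\mathcal K)<\infty$ and $\operatorname{Fix}(\mathbf T)$ is bounded, then $$\lim_{n\to\infty}d_\Omega(x^\star_n)=0,\qquad d_\Omega(x):=\inf_{y\in\Omega}\|x-y\|.$$ -/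

import Mathlib

open Filter Topology
open scoped Pointwise

namespace HSDM

noncomputable section

section ConvexAnalysis

variable {H : Type*} [NormedAddCommGroup H] [InnerProductSpace ℝ H]

/-- The effective domain `dom f` of an extended real valued function. -/
def effDom (f : H → EReal) : Set H := {x | f x < ⊤}

/-- `f ∈ Γ₀(H)`: `f : H → (-∞, ∞]` is proper, lower semicontinuous and convex. -/
structure IsGamma0 (f : H → EReal) : Prop where
  ne_bot : ∀ x, f x ≠ ⊥
  proper : (effDom f).Nonempty
  lsc : LowerSemicontinuous f
  convex : ∀ x ∈ effDom f, ∀ y ∈ effDom f, ∀ t : ℝ, 0 < t → t < 1 →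
    f (t • x + (1 - t) • y) ≤ (t : EReal) * f x + ((1 - t : ℝ) : EReal) * f y

/-- The set of minimizers of `φ` over the set `S`. -/
def argminOn {E β : Type*} [Preorder β] (φ : E → β) (S : Set E) : Set E :=
  {x | x ∈ S ∧ IsMinOn φ S x}

/-- The conical hull `{t x | t > 0, x ∈ C}`. -/
def conicalHull (C : Set H) : Set H := {z | ∃ t : ℝ, 0 < t ∧ ∃ x ∈ C, z = t • x}

/-- The strong relative interior of `C`: the points `x ∈ C` such that the conical hull of `C - x`
is the closed linear span of `C - x`. -/
def sri (C : Set H) : Set H :=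
  {x | x ∈ C ∧ conicalHull (C - {x}) = closure (Submodule.span ℝ (C - {x}) : Set H)}

open Classical in
/-- The indicator function `ι_C`. -/
def indicatorFun (C : Set H) (x : H) : EReal := if x ∈ C then 0 else ⊤

/-- The proximity operator: `prox f x` is the minimizer of `y ↦ f y + ‖y - x‖² / 2`, which exists
and is unique for every `f ∈ Γ₀(H)` on a Hilbert space. -/
def prox (f : H → EReal) (x : H) : H :=
  Classical.epsilon fun p =>
    p ∈ argminOn (fun y => f y + ((‖y - x‖ ^ 2 / 2 : ℝ) : EReal)) Set.univ

/-- The reflected proximity operator `2 prox f - I`. -/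
def rprox (f : H → EReal) (x : H) : H := (2 : ℝ) • prox f x - x

/-- The Douglas–Rachford splitting operator `(2 prox φ - I) ∘ (2 prox ψ - I)`. -/
def drsOperator (φ ψ : H → EReal) : H → H := rprox φ ∘ rprox ψ

/-- `a` is the Gâteaux gradient of `Ψ` at `x`. -/
def HasGateauxGradientAt (Ψ : H → ℝ) (a x : H) : Prop :=
  ∀ h : H, HasLineDerivAt ℝ Ψ (inner ℝ a h) x h

/-- `T` is nonexpansive, has a fixed point, and moves every other point strictly closer to each of
its fixed points. -/
def IsAttractingNonexpansive (T : H → H) : Prop :=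
  LipschitzWith 1 T ∧ (Function.fixedPoints T).Nonempty ∧
    ∀ x ∉ Function.fixedPoints T, ∀ z ∈ Function.fixedPoints T, ‖T x - z‖ < ‖x - z‖

/-- The operator `(1 - α) I + α T`. -/
def relaxed (α : ℝ) (T : H → H) (z : H) : H := (1 - α) • z + α • T z

end ConvexAnalysis

section ProductSpace

variable {X K : Type*} [NormedAddCommGroup X] [InnerProductSpace ℝ X] [CompleteSpace X]
  [NormedAddCommGroup K] [InnerProductSpace ℝ K] [CompleteSpace K]

/-- The operator `I + A A*` is invertible in the bounded operators on `K`. -/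
theorem isUnit_one_add_mul_adjoint (A : X →L[ℝ] K) :
    IsUnit (1 + A ∘L ContinuousLinearMap.adjoint A) := by
  refine ContinuousLinearMap.isUnit_of_forall_le_norm_inner_map _ (c := 1) one_pos fun x => ?_
  have h : inner ℝ ((1 + A ∘L ContinuousLinearMap.adjoint A) x) x =
      ‖x‖ ^ 2 + ‖ContinuousLinearMap.adjoint A x‖ ^ 2 := by
    simp only [add_apply, one_apply_eq_self,
      ContinuousLinearMap.comp_apply, inner_add_left, real_inner_self_eq_norm_sq]
    rw [← ContinuousLinearMap.adjoint_inner_right, real_inner_self_eq_norm_sq]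
  rw [h, Real.norm_of_nonneg (by positivity)]
  simp

/-- The bounded operator `(I + A A*)⁻¹`. -/
def resolventAA (A : X →L[ℝ] K) : K →L[ℝ] K :=
  Ring.inverse (1 + A ∘L ContinuousLinearMap.adjoint A)

/-- `F(x, y) = f(x) + g(y)` on the Hilbert product `X × K`. -/
def sumFun (f : X → EReal) (g : K → EReal) (z : WithLp 2 (X × K)) : EReal := f z.fst + g z.snd

/-- The operator `(x, y) ↦ A x - y`, whose null space is the graph of `A`. -/
def checkA (A : X →L[ℝ] K) : WithLp 2 (X × K) →L[ℝ] K :=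
  A ∘L WithLp.fstL 2 ℝ X K - WithLp.sndL 2 ℝ X K

/-- The bounded linear map `Ξ = Q_X ∘ P_N : X × K → X`, where `P_N` is the orthogonal projection
onto the null space of `(x, y) ↦ A x - y` and `Q_X (x, y) = x`. -/
def Xi (A : X →L[ℝ] K) : WithLp 2 (X × K) →L[ℝ] X :=
  WithLp.fstL 2 ℝ X K ∘L (checkA A).ker.starProjection

/-- `p = x - A*(I + A A*)⁻¹(A x - y)`. -/
def graphPoint (A : X →L[ℝ] K) (x : X) (y : K) : X :=
  x - ContinuousLinearMap.adjoint A (resolventAA A (A x - y))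

/-- The solution set `S_p = argmin (f + g ∘ A)`. -/
def solSet (f : X → EReal) (g : K → EReal) (A : X →L[ℝ] K) : Set X :=
  argminOn (fun x => f x + g (A x)) Set.univ

/-- The operator `(x, y) ↦ (x_T, y_T)` with `p = x - A*(I + A A*)⁻¹(A x - y)`,
`(x_{1/2}, y_{1/2}) = (2 p - x, 2 A p - y)`,
`(x_T, y_T) = (2 prox f x_{1/2} - x_{1/2}, 2 prox g y_{1/2} - y_{1/2})`. -/
def TDRSI (f : X → EReal) (g : K → EReal) (A : X →L[ℝ] K) (z : WithLp 2 (X × K)) :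
    WithLp 2 (X × K) :=
  let x : X := z.fst
  let y : K := z.snd
  let p : X := graphPoint A x y
  let xh : X := (2 : ℝ) • p - x
  let yh : K := (2 : ℝ) • A p - y
  WithLp.toLp 2 ((2 : ℝ) • prox f xh - xh, (2 : ℝ) • prox g yh - yh)

/-- The update `(x_{n+1/2}, y_{n+1/2}) ↦ (x_{n+1}, y_{n+1})` with step size `l`; `G` is the
gradient of the second stage function. -/
def descentStep (A : X →L[ℝ] K) (G : X → X) (l : ℝ) (w : WithLp 2 (X × K)) :
    WithLp 2 (X × K) :=
  let xs : X := graphPoint A w.fst w.snd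
  WithLp.toLp 2
    (w.fst - l • (G xs - ContinuousLinearMap.adjoint A (resolventAA A (A (G xs)))),
      w.snd - l • resolventAA A (A (G xs)))

/-- The iterates `(x_n, y_n)` started at `z₀ = (x₀, y₀)`. -/
def iterate (f : X → EReal) (g : K → EReal) (A : X →L[ℝ] K) (G : X → X) (α : ℝ) (lam : ℕ → ℝ)
    (z₀ : WithLp 2 (X × K)) : ℕ → WithLp 2 (X × K)
  | 0 => z₀
  | n + 1 => descentStep A G (lam (n + 1))
      (relaxed α (TDRSI f g A) (iterate f g A G α lam z₀ n))

/-- The intermediate points `(x_{n+1/2}, y_{n+1/2})`. -/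
def halfIterate (f : X → EReal) (g : K → EReal) (A : X →L[ℝ] K) (G : X → X) (α : ℝ)
    (lam : ℕ → ℝ) (z₀ : WithLp 2 (X × K)) (n : ℕ) : WithLp 2 (X × K) :=
  relaxed α (TDRSI f g A) (iterate f g A G α lam z₀ n)

/-- The output sequence; the value at `n` is `x*_{n+1}`, computed from
`(x_{n+1/2}, y_{n+1/2})`. -/
def xStarSucc (f : X → EReal) (g : K → EReal) (A : X →L[ℝ] K) (G : X → X) (α : ℝ)
    (lam : ℕ → ℝ) (z₀ : WithLp 2 (X × K)) (n : ℕ) : X :=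
  graphPoint A (halfIterate f g A G α lam z₀ n).fst (halfIterate f g A G α lam z₀ n).snd

end ProductSpace

end

end HSDM

open HSDM

open HSDM

/-! Everything rests on subgradients. A subgradient `x - p` of a function at `p` identifies `p` as
its proximal point at `x`, and monotonicity of subgradients makes `2 prox - I` nonexpansive. On the
product space the prox of `F` acts componentwise, and that of the graph indicator is the orthogonal
projection `P` onto the graph `N`. Hence the explicit operator is the Douglas–Rachford operator, and
`z` is fixed exactly when `P z - z`, a normal to `N`, is a subgradient of `F` at `P z`.

Such a normal subgradient forces `P z` to minimize `F` over `N`. Conversely, a minimizer yields a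
fixed point once a Lagrange multiplier exists (`IsGamma0.exists_multiplier`). This is where the
`sri` condition enters: it makes the image under `B` of a bounded sublevel set absorbing in a closed
subspace, Baire's theorem turns absorbing into a neighbourhood of 0, and Hahn–Banach separation
gives the multiplier.

Relaxation makes the operator attracting. In finite dimension, compactness of its fixed point set
`F` upgrades this to a uniform decrease of the distance to `F` outside any neighbourhood
(`IsAttractingNonexpansive.exists_infDist_le_sub`). That decrease outweighs the gradient steps, so
the half-iterates stay bounded and approach `F`. Near `F` but away from the minimizers, `Θ` exceeds
its minimum by a fixed amount, so each gradient step gains a multiple of `λ`. Since `∑ λ` diverges,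
the distance to the minimizers tends to 0, and `Ξ` carries the limit down to `X`. -/

namespace HSDM

/-! ### Subgradients and proximity operators in `Γ₀` -/

section Subgradients

variable {H : Type*} [NormedAddCommGroup H] [InnerProductSpace ℝ H] {f : H → EReal}

/-- `u` is a subgradient of `f` at the point `p` of its domain. -/
def IsSubgradientAt (f : H → EReal) (u p : H) : Prop :=
  f p < ⊤ ∧ ∀ y, f p + ((inner ℝ u (y - p) : ℝ) : EReal) ≤ f y

theorem exists_real_eq {a : EReal} (hb : a ≠ ⊥) (ht : a < ⊤) : ∃ r : ℝ, a = r :=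
  ⟨a.toReal, (EReal.coe_toReal ht.ne hb).symm⟩

/-- Convexity through real upper bounds, endpoints included, so that later estimates avoid `EReal`
arithmetic. -/
theorem IsGamma0.combo_le (hf : IsGamma0 f) {x y : H} {a b t : ℝ} (hx : f x ≤ a) (hy : f y ≤ b)
    (ht0 : 0 ≤ t) (ht1 : t ≤ 1) :
    f (t • x + (1 - t) • y) ≤ ((t * a + (1 - t) * b : ℝ) : EReal) := by
  rcases ht0.eq_or_lt with rfl | ht0
  · simpa using hy
  rcases ht1.eq_or_lt with rfl | ht1
  · simpa using hx
  have hxt : f x < ⊤ := hx.trans_lt (EReal.coe_lt_top a)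
  have hyt : f y < ⊤ := hy.trans_lt (EReal.coe_lt_top b)
  refine (hf.convex x hxt y hyt t ht0 ht1).trans ?_
  obtain ⟨r, hr⟩ := exists_real_eq (hf.ne_bot x) hxt
  obtain ⟨s, hs⟩ := exists_real_eq (hf.ne_bot y) hyt
  rw [hr] at hx ⊢
  rw [hs] at hy ⊢
  rw [EReal.coe_le_coe_iff] at hx hy
  rw [← EReal.coe_mul, ← EReal.coe_mul, ← EReal.coe_add, EReal.coe_le_coe_iff]
  have : 0 ≤ 1 - t := by linarith
  gcongr

theorem le_of_tendsto_of_lowerSemicontinuous {E : Type*} [TopologicalSpace E] {f : E → EReal}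
    (hf : LowerSemicontinuous f) {u : ℕ → E} {r : ℕ → ℝ}
    {p : E} {s : ℝ} (hu : Tendsto u atTop (𝓝 p)) (hr : Tendsto r atTop (𝓝 s))
    (h : ∀ n, f (u n) ≤ r n) : f p ≤ s := by
  refine le_of_forall_lt fun c hc => ?_
  by_contra hcs
  push Not at hcs
  obtain ⟨d, hd1, hd2⟩ := exists_between hc
  have h1 := hu.eventually (hf p d hd2)
  have hr' : Tendsto (fun n => (r n : EReal)) atTop (𝓝 (s : EReal)) :=
    (continuous_coe_real_ereal.tendsto s).comp hr
  have h2 := hr'.eventually (gt_mem_nhds (hcs.trans_lt hd1))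
  obtain ⟨n, h1, h2⟩ := (h1.and h2).exists
  exact absurd (h n) (not_le.2 (h2.trans h1))

/-- A function in `Γ₀` decreases at most linearly. -/
theorem IsGamma0.exists_lower_bound (hf : IsGamma0 f) :
    ∃ (x₀ : H) (a c : ℝ), 0 ≤ c ∧ ∀ y, ((a - c * ‖y - x₀‖ : ℝ) : EReal) ≤ f y := by
  obtain ⟨x₀, hx₀⟩ := hf.proper
  obtain ⟨s, hs⟩ := exists_real_eq (hf.ne_bot x₀) hx₀
  have hlt : ((s - 1 : ℝ) : EReal) < f x₀ := by
    rw [hs, EReal.coe_lt_coe_iff]; linarith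
  obtain ⟨r, hr, hball⟩ := Metric.eventually_nhds_iff.1 (hf.lsc x₀ _ hlt)
  refine ⟨x₀, s - 1, 2 / r, by positivity, fun y => ?_⟩
  rcases lt_or_ge (dist y x₀) r with h | h
  · refine le_trans ?_ (hball h).le
    rw [EReal.coe_le_coe_iff]
    have : 0 ≤ 2 / r * ‖y - x₀‖ := by positivity
    linarith
  · rcases eq_top_or_lt_top (f y) with hy | hy
    · rw [hy]; exact le_top
    obtain ⟨b, hb⟩ := exists_real_eq (hf.ne_bot y) hy
    rw [dist_eq_norm] at h
    have hn : 0 < ‖y - x₀‖ := hr.trans_le h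
    -- This `t` puts the point of the segment from `x₀` to `y` at distance `r / 2` from `x₀`, inside
    -- the ball where `f > s - 1`; convexity then bounds `f y` from below.
    set t : ℝ := r / 2 / ‖y - x₀‖ with ht
    have ht0 : 0 < t := by positivity
    have htn : t * ‖y - x₀‖ = r / 2 := by rw [ht]; field_simp
    have ht1 : t ≤ 1 := by rw [ht, div_le_one hn]; linarith
    have hd : dist (t • y + (1 - t) • x₀) x₀ < r := by
      have : t • y + (1 - t) • x₀ - x₀ = t • (y - x₀) := by module
      rw [dist_eq_norm, this, norm_smul, Real.norm_of_nonneg ht0.le, htn]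
      linarith
    have h1 := (hball hd).le.trans (hf.combo_le hb.le hs.le ht0.le ht1)
    rw [EReal.coe_le_coe_iff] at h1
    rw [hb, EReal.coe_le_coe_iff]
    have h2 : t * (2 / r * ‖y - x₀‖) = 1 := by
      rw [show t * (2 / r * ‖y - x₀‖) = 2 / r * (t * ‖y - x₀‖) by ring, htn]; field_simp
    have h3 : t * (s - 1 - 2 / r * ‖y - x₀‖) ≤ t * b := by nlinarith
    exact le_of_mul_le_mul_left h3 ht0

theorem half_sq_expand (x p y : H) :
    ‖y - x‖ ^ 2 / 2 = ‖p - x‖ ^ 2 / 2 - inner ℝ (x - p) (y - p) + ‖y - p‖ ^ 2 / 2 := by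
  have : y - x = (y - p) - (x - p) := by abel
  rw [this, norm_sub_sq_real, ← norm_neg (p - x), neg_sub, real_inner_comm]
  ring

/-- The quadratic term makes the objective strongly convex, so a minimizing sequence is Cauchy and
no weak compactness is needed. `S` collects the real upper bounds of objective values, so the
infimum is taken in `ℝ`. -/
theorem IsGamma0.exists_prox_minimizer [CompleteSpace H] (hf : IsGamma0 f) (x : H) :
    ∃ p, p ∈ argminOn (fun y => f y + ((‖y - x‖ ^ 2 / 2 : ℝ) : EReal)) Set.univ := by
  set S : Set ℝ := {r | ∃ y, f y ≤ ((r - ‖y - x‖ ^ 2 / 2 : ℝ) : EReal)} with hS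
  have hne : S.Nonempty := by
    obtain ⟨y, hy⟩ := hf.proper
    obtain ⟨s, hs⟩ := exists_real_eq (hf.ne_bot y) hy
    exact ⟨s + ‖y - x‖ ^ 2 / 2, y, by rw [hs, add_sub_cancel_right]⟩
  have hbdd : BddBelow S := by
    obtain ⟨x₀, a, c, hc, hlow⟩ := hf.exists_lower_bound
    refine ⟨a - c * ‖x - x₀‖ - c ^ 2 / 2, ?_⟩
    rintro r ⟨y, hy⟩
    have h := (hlow y).trans hy
    rw [EReal.coe_le_coe_iff] at h
    have h2 : ‖y - x₀‖ ≤ ‖y - x‖ + ‖x - x₀‖ := norm_sub_le_norm_sub_add_norm_sub y x x₀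
    nlinarith [sq_nonneg (‖y - x‖ - c), mul_le_mul_of_nonneg_left h2 hc]
  set m := sInf S
  have hm : ∀ {y : H} {r : ℝ}, f y ≤ ((r - ‖y - x‖ ^ 2 / 2 : ℝ) : EReal) → m ≤ r :=
    fun h => csInf_le hbdd ⟨_, h⟩
  have hmin : ∀ n : ℕ, ∃ y, f y ≤ ((m + 1 / ((n : ℝ) + 1) - ‖y - x‖ ^ 2 / 2 : ℝ) : EReal) := by
    intro n
    have hpos : (0 : ℝ) < 1 / ((n : ℝ) + 1) := by positivity
    obtain ⟨r, ⟨y, hy⟩, hr⟩ :=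
      exists_lt_of_csInf_lt hne (show m < m + 1 / ((n : ℝ) + 1) by linarith)
    exact ⟨y, hy.trans (EReal.coe_le_coe_iff.2 (by linarith))⟩
  choose y hy using hmin
  -- The objective at the midpoint is at least `m`, while the parallelogram law gains `‖y n - y k‖ ^
  -- 2 / 8` there.
  have hdist : ∀ n k : ℕ, ‖y n - y k‖ ^ 2 ≤ 4 * (1 / ((n : ℝ) + 1) + 1 / ((k : ℝ) + 1)) := by
    intro n k
    have h := hf.combo_le (hy n) (hy k) (t := 1 / 2) (by norm_num) (by norm_num)
    have hid : ‖((1 / 2 : ℝ) • y n + (1 - 1 / 2 : ℝ) • y k) - x‖ ^ 2 / 2 =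
        ‖y n - x‖ ^ 2 / 4 + ‖y k - x‖ ^ 2 / 4 - ‖y n - y k‖ ^ 2 / 8 := by
      have e1 : ((1 / 2 : ℝ) • y n + (1 - 1 / 2 : ℝ) • y k) - x
          = (1 / 2 : ℝ) • ((y n - x) + (y k - x)) := by module
      have e2 : y n - y k = (y n - x) - (y k - x) := by abel
      rw [e1, e2, norm_smul, mul_pow, norm_add_sq_real, norm_sub_sq_real (y n - x) (y k - x)]
      norm_num
      ring
    have h2 := hm (r := m + (1 / ((n : ℝ) + 1) + 1 / ((k : ℝ) + 1)) / 2 - ‖y n - y k‖ ^ 2 / 8)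
      (h.trans (EReal.coe_le_coe_iff.2 (by rw [hid]; linarith)))
    linarith
  have hcauchy : CauchySeq y := by
    rw [Metric.cauchySeq_iff']
    intro ε hε
    obtain ⟨N, hN⟩ := exists_nat_one_div_lt (show 0 < ε ^ 2 / 8 by positivity)
    refine ⟨N, fun n hn => ?_⟩
    have h1 : 1 / ((n : ℝ) + 1) ≤ 1 / ((N : ℝ) + 1) := by
      gcongr
    have h2 := hdist n N
    rw [dist_eq_norm]
    refine lt_of_pow_lt_pow_left₀ 2 hε.le (by linarith)
  obtain ⟨p, hp⟩ := cauchySeq_tendsto_of_complete hcauchy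
  have hlim : Tendsto (fun n : ℕ => m + 1 / ((n : ℝ) + 1) - ‖y n - x‖ ^ 2 / 2) atTop
      (𝓝 (m + 0 - ‖p - x‖ ^ 2 / 2)) :=
    (tendsto_const_nhds.add tendsto_one_div_add_atTop_nhds_zero_nat).sub
      ((((hp.sub_const x).norm).pow 2).div_const 2)
  have hfp := le_of_tendsto_of_lowerSemicontinuous hf.lsc hp hlim hy
  refine ⟨p, Set.mem_univ p, fun w _ => ?_⟩
  obtain ⟨s, hs⟩ := exists_real_eq (hf.ne_bot p) (hfp.trans_lt (EReal.coe_lt_top _))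
  show f p + ((‖p - x‖ ^ 2 / 2 : ℝ) : EReal) ≤ f w + ((‖w - x‖ ^ 2 / 2 : ℝ) : EReal)
  rcases eq_top_or_lt_top (f w) with hw | hw
  · rw [hw, EReal.top_add_coe]; exact le_top
  obtain ⟨b, hb⟩ := exists_real_eq (hf.ne_bot w) hw
  have h3 : m ≤ b + ‖w - x‖ ^ 2 / 2 := hm (y := w) (by rw [hb, add_sub_cancel_right])
  rw [hs, EReal.coe_le_coe_iff] at hfp
  rw [hs, hb, ← EReal.coe_add, ← EReal.coe_add, EReal.coe_le_coe_iff]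
  linarith

/-- First-order optimality: compare `p` with `t • y + (1 - t) • p`, divide by `t` and let `t → 0`.
-/
theorem IsGamma0.isSubgradientAt_of_mem_argminOn (hf : IsGamma0 f) {x p : H}
    (hp : p ∈ argminOn (fun y => f y + ((‖y - x‖ ^ 2 / 2 : ℝ) : EReal)) Set.univ) :
    IsSubgradientAt f (x - p) p := by
  have hmin : ∀ y, f p + ((‖p - x‖ ^ 2 / 2 : ℝ) : EReal) ≤ f y + ((‖y - x‖ ^ 2 / 2 : ℝ) : EReal) :=
    fun y => hp.2 (Set.mem_univ y)
  have hpt : f p < ⊤ := by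
    by_contra h
    rw [not_lt_top_iff] at h
    obtain ⟨y, hy⟩ := hf.proper
    obtain ⟨s, hs⟩ := exists_real_eq (hf.ne_bot y) hy
    have := hmin y
    rw [h, hs, EReal.top_add_coe, ← EReal.coe_add, top_le_iff] at this
    exact EReal.coe_ne_top _ this
  obtain ⟨a, ha⟩ := exists_real_eq (hf.ne_bot p) hpt
  refine ⟨hpt, fun y => ?_⟩
  rcases eq_top_or_lt_top (f y) with hy | hy
  · rw [hy]; exact le_top
  obtain ⟨b, hb⟩ := exists_real_eq (hf.ne_bot y) hy
  rw [ha, hb, ← EReal.coe_add, EReal.coe_le_coe_iff]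
  have key : ∀ t : ℝ, 0 < t → t < 1 → a + inner ℝ (x - p) (y - p) ≤ b + t * (‖y - p‖ ^ 2 / 2) := by
    intro t ht0 ht1
    have h1 := hmin (t • y + (1 - t) • p)
    have h2 := hf.combo_le hb.le ha.le ht0.le ht1.le
    have h3 := h1.trans (add_le_add_left h2 _)
    rw [ha, ← EReal.coe_add, ← EReal.coe_add, EReal.coe_le_coe_iff,
      half_sq_expand x p (t • y + (1 - t) • p)] at h3
    have e : t • y + (1 - t) • p - p = t • (y - p) := by module
    rw [e, inner_smul_right, norm_smul, mul_pow, Real.norm_of_nonneg ht0.le] at h3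
    have : t * (a + inner ℝ (x - p) (y - p)) ≤ t * (b + t * (‖y - p‖ ^ 2 / 2)) := by nlinarith
    exact le_of_mul_le_mul_left this ht0
  have hlim : Tendsto (fun t : ℝ => b + t * (‖y - p‖ ^ 2 / 2)) (𝓝[>] 0)
      (𝓝 (b + 0 * (‖y - p‖ ^ 2 / 2))) :=
    ((continuous_const.add (continuous_id.mul continuous_const)).tendsto 0).mono_left
      nhdsWithin_le_nhds
  rw [zero_mul, add_zero] at hlim
  refine ge_of_tendsto hlim ?_
  filter_upwards [Ioo_mem_nhdsGT (zero_lt_one' ℝ)] with t ht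
  exact key t ht.1 ht.2

/-- Completing the square turns the subgradient inequality into quadratic growth of the objective
away from `p`, so `p` is its only minimizer. -/
theorem IsSubgradientAt.prox_eq (hbot : ∀ x, f x ≠ ⊥) {x p : H}
    (hp : IsSubgradientAt f (x - p) p) : prox f x = p := by
  obtain ⟨a, ha⟩ := exists_real_eq (hbot p) hp.1
  have hstrong : ∀ y, ((a + ‖p - x‖ ^ 2 / 2 + ‖y - p‖ ^ 2 / 2 : ℝ) : EReal) ≤
      f y + ((‖y - x‖ ^ 2 / 2 : ℝ) : EReal) := by
    intro y
    rcases eq_top_or_lt_top (f y) with hy | hy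
    · rw [hy, EReal.top_add_coe]; exact le_top
    obtain ⟨b, hb⟩ := exists_real_eq (hbot y) hy
    have h := hp.2 y
    rw [ha, hb, ← EReal.coe_add, EReal.coe_le_coe_iff] at h
    rw [hb, ← EReal.coe_add, EReal.coe_le_coe_iff, half_sq_expand x p y]
    linarith
  have hex : ∃ q, q ∈ argminOn (fun y => f y + ((‖y - x‖ ^ 2 / 2 : ℝ) : EReal)) Set.univ := by
    refine ⟨p, Set.mem_univ p, fun y _ => ?_⟩
    refine le_trans ?_ (hstrong y)
    simp only [ha]
    rw [← EReal.coe_add, EReal.coe_le_coe_iff]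
    have := sq_nonneg ‖y - p‖
    linarith
  have hspec : prox f x ∈ argminOn (fun y => f y + ((‖y - x‖ ^ 2 / 2 : ℝ) : EReal)) Set.univ :=
    Classical.epsilon_spec hex
  have h := (hstrong (prox f x)).trans (hspec.2 (Set.mem_univ p))
  simp only [ha] at h
  rw [← EReal.coe_add, EReal.coe_le_coe_iff] at h
  have h0 : ‖prox f x - p‖ = 0 := by
    have : ‖prox f x - p‖ ^ 2 ≤ 0 := by linarith
    exact pow_eq_zero_iff two_ne_zero |>.1 (le_antisymm this (sq_nonneg _))
  exact sub_eq_zero.1 (norm_eq_zero.1 h0)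

theorem IsGamma0.isSubgradientAt_prox [CompleteSpace H] (hf : IsGamma0 f) (x : H) :
    IsSubgradientAt f (x - prox f x) (prox f x) :=
  hf.isSubgradientAt_of_mem_argminOn (Classical.epsilon_spec (hf.exists_prox_minimizer x))

theorem IsSubgradientAt.inner_sub_nonneg (hbot : ∀ x, f x ≠ ⊥) {u v p q : H}
    (hp : IsSubgradientAt f u p) (hq : IsSubgradientAt f v q) :
    0 ≤ inner ℝ (u - v) (p - q) := by
  obtain ⟨a, ha⟩ := exists_real_eq (hbot p) hp.1
  obtain ⟨b, hb⟩ := exists_real_eq (hbot q) hq.1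
  have h1 := hp.2 q
  have h2 := hq.2 p
  rw [ha, hb, ← EReal.coe_add, EReal.coe_le_coe_iff] at h1 h2
  rw [← neg_sub p q, inner_neg_right] at h1
  rw [inner_sub_left]
  linarith

/-- With `p`, `q` the proximal points, `‖2(p - q) - (x - y)‖² = ‖x - y‖² - 4⟪(x - p) - (y - q), p -
q⟫`, and the inner product is nonnegative by monotonicity. -/
theorem lipschitzWith_rprox (hbot : ∀ x, f x ≠ ⊥)
    (h : ∀ x, IsSubgradientAt f (x - prox f x) (prox f x)) : LipschitzWith 1 (rprox f) := by
  refine LipschitzWith.of_dist_le_mul fun x y => ?_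
  rw [dist_eq_norm, dist_eq_norm, NNReal.coe_one, one_mul]
  refine le_of_sq_le_sq ?_ (norm_nonneg _)
  have hm := (h x).inner_sub_nonneg hbot (h y)
  set p := prox f x with hp
  set q := prox f y with hq
  have e1 : rprox f x - rprox f y = (2 : ℝ) • (p - q) - (x - y) := by
    simp only [rprox, ← hp, ← hq]; module
  have e2 : x - p - (y - q) = (x - y) - (p - q) := by abel
  rw [e2, inner_sub_left, real_inner_self_eq_norm_sq, real_inner_comm] at hm
  rw [e1, norm_sub_sq_real, norm_smul, inner_smul_left]
  simp only [Real.norm_ofNat, RCLike.conj_to_real]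
  nlinarith

end Subgradients

end HSDM

namespace HSDM

/-! ### The graph projection and Douglas–Rachford fixed points -/

section ProductSpace

variable {X K : Type*}

theorem sumFun_ne_bot {f : X → EReal} {g : K → EReal} (hf : ∀ x, f x ≠ ⊥) (hg : ∀ y, g y ≠ ⊥)
    (z : WithLp 2 (X × K)) : sumFun f g z ≠ ⊥ := by
  simp [sumFun, EReal.add_eq_bot_iff, hf, hg]

theorem sumFun_lt_top_iff {f : X → EReal} {g : K → EReal} (hf : ∀ x, f x ≠ ⊥)
    (hg : ∀ y, g y ≠ ⊥) {z : WithLp 2 (X × K)} :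
    sumFun f g z < ⊤ ↔ f z.fst < ⊤ ∧ g z.snd < ⊤ := by
  refine ⟨fun h => ⟨?_, ?_⟩, fun h => EReal.add_lt_top h.1.ne h.2.ne⟩
  · by_contra h1
    rw [not_lt_top_iff] at h1
    rw [sumFun, h1, EReal.top_add_of_ne_bot (hg _)] at h
    exact lt_irrefl _ h
  · by_contra h1
    rw [not_lt_top_iff] at h1
    rw [sumFun, h1, EReal.add_top_of_ne_bot (hf _)] at h
    exact lt_irrefl _ h

variable [NormedAddCommGroup X] [InnerProductSpace ℝ X]
  [NormedAddCommGroup K] [InnerProductSpace ℝ K]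

theorem IsSubgradientAt.sumFun {f : X → EReal} {g : K → EReal} {u p : WithLp 2 (X × K)}
    (hu : IsSubgradientAt f u.fst p.fst) (hv : IsSubgradientAt g u.snd p.snd) :
    IsSubgradientAt (sumFun f g) u p := by
  refine ⟨EReal.add_lt_top hu.1.ne hv.1.ne, fun w => ?_⟩
  have h := add_le_add (hu.2 w.fst) (hv.2 w.snd)
  rw [add_add_add_comm, ← EReal.coe_add] at h
  exact h

theorem prox_sumFun [CompleteSpace X] [CompleteSpace K] {f : X → EReal} {g : K → EReal}
    (hf : IsGamma0 f) (hg : IsGamma0 g) (z : WithLp 2 (X × K)) :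
    prox (sumFun f g) z = WithLp.toLp 2 (prox f z.fst, prox g z.snd) :=
  IsSubgradientAt.prox_eq (sumFun_ne_bot hf.ne_bot hg.ne_bot)
    (IsSubgradientAt.sumFun (hf.isSubgradientAt_prox z.fst) (hg.isSubgradientAt_prox z.snd))

theorem indicatorFun_ne_bot {H : Type*} (C : Set H) [NormedAddCommGroup H] [InnerProductSpace ℝ H]
    (z : H) : indicatorFun C z ≠ ⊥ := by
  unfold indicatorFun
  split_ifs <;> simp

theorem isSubgradientAt_indicatorFun {H : Type*} [NormedAddCommGroup H] [InnerProductSpace ℝ H]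
    (N : Submodule ℝ H) [N.HasOrthogonalProjection] (z : H) :
    IsSubgradientAt (indicatorFun (N : Set H)) (z - N.starProjection z) (N.starProjection z) := by
  have hp : indicatorFun (N : Set H) (N.starProjection z) = 0 :=
    if_pos (N.starProjection_apply_mem z)
  refine ⟨by rw [hp]; exact EReal.zero_lt_top, fun y => ?_⟩
  rw [hp, zero_add]
  by_cases hy : y ∈ N
  · rw [N.starProjection_inner_eq_zero z _ (N.sub_mem hy (N.starProjection_apply_mem z))]
    simp [indicatorFun, hy]
  · simp [indicatorFun, hy]

theorem prox_indicatorFun {H : Type*} [NormedAddCommGroup H] [InnerProductSpace ℝ H]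
    (N : Submodule ℝ H) [N.HasOrthogonalProjection] (z : H) :
    prox (indicatorFun (N : Set H)) z = N.starProjection z :=
  (isSubgradientAt_indicatorFun N z).prox_eq (indicatorFun_ne_bot _)

theorem mem_ker_checkA {A : X →L[ℝ] K} {z : WithLp 2 (X × K)} :
    z ∈ (checkA A).ker ↔ A z.fst = z.snd := by
  simp [checkA, sub_eq_zero]

variable [CompleteSpace X] [CompleteSpace K]

theorem resolventAA_spec (A : X →L[ℝ] K) (y : K) :
    resolventAA A y + A (ContinuousLinearMap.adjoint A (resolventAA A y)) = y := by
  have h := Ring.mul_inverse_cancel _ (isUnit_one_add_mul_adjoint A)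
  exact DFunLike.congr_fun h y

/-- The orthogonal projection onto the graph of `A`. -/
theorem starProjection_ker_checkA (A : X →L[ℝ] K) (z : WithLp 2 (X × K)) :
    (checkA A).ker.starProjection z =
      WithLp.toLp 2 (graphPoint A z.fst z.snd, A (graphPoint A z.fst z.snd)) := by
  refine Submodule.eq_starProjection_of_mem_of_inner_eq_zero (mem_ker_checkA.2 rfl) fun w hw => ?_
  rw [mem_ker_checkA] at hw
  have h := resolventAA_spec A (A z.fst - z.snd)
  rw [WithLp.prod_inner_apply]
  simp only [graphPoint]
  -- The residual of the projection is `(A* r, -r)`, which is orthogonal to every `(x, A x)`.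
  set r := resolventAA A (A z.fst - z.snd) with hr
  have e1 : (z - WithLp.toLp 2 (z.fst - ContinuousLinearMap.adjoint A r,
      A (z.fst - ContinuousLinearMap.adjoint A r))).ofLp.1 = ContinuousLinearMap.adjoint A r := by
    change z.fst - (z.fst - ContinuousLinearMap.adjoint A r) = _
    abel
  have e2 : (z - WithLp.toLp 2 (z.fst - ContinuousLinearMap.adjoint A r,
      A (z.fst - ContinuousLinearMap.adjoint A r))).ofLp.2 = -r := by
    change z.snd - A (z.fst - ContinuousLinearMap.adjoint A r) = _
    rw [map_sub, ← sub_eq_zero]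
    calc _ = (r + A (ContinuousLinearMap.adjoint A r)) - (A z.fst - z.snd) := by abel
      _ = 0 := by rw [h, sub_self]
  rw [e1, e2, ContinuousLinearMap.adjoint_inner_left, inner_neg_left]
  change inner ℝ r (A w.fst) + -inner ℝ r w.snd = 0
  rw [hw, add_neg_cancel]

theorem Xi_apply (A : X →L[ℝ] K) (z : WithLp 2 (X × K)) :
    Xi A z = graphPoint A z.fst z.snd := by
  change ((checkA A).ker.starProjection z).fst = _
  rw [starProjection_ker_checkA]
  rfl

theorem starProjection_eq_Xi (A : X →L[ℝ] K) (z : WithLp 2 (X × K)) :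
    (checkA A).ker.starProjection z = WithLp.toLp 2 (Xi A z, A (Xi A z)) := by
  rw [starProjection_ker_checkA, Xi_apply]

/-- The projection is self-adjoint, so `Ξ* u` is the projection of `(u, 0)`. This matches the
explicit update with a gradient step for `Θ`. -/
theorem adjoint_Xi_apply (A : X →L[ℝ] K) (u : X) :
    ContinuousLinearMap.adjoint (Xi A) u =
      WithLp.toLp 2 (u - ContinuousLinearMap.adjoint A (resolventAA A (A u)),
        resolventAA A (A u)) := by
  have h1 : ContinuousLinearMap.adjoint (Xi A) u =
      (checkA A).ker.starProjection (WithLp.toLp 2 (u, 0)) := by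
    refine ext_inner_right ℝ fun w => ?_
    rw [ContinuousLinearMap.adjoint_inner_left, Submodule.inner_starProjection_left_eq_right,
      starProjection_eq_Xi, WithLp.prod_inner_apply]
    simp
  have hp : graphPoint A u 0 = u - ContinuousLinearMap.adjoint A (resolventAA A (A u)) := by
    rw [graphPoint, sub_zero]
  rw [h1, starProjection_ker_checkA]
  change WithLp.toLp 2 (graphPoint A u 0, A (graphPoint A u 0)) = _
  have h := resolventAA_spec A (A u)
  rw [hp, map_sub]
  congr 2
  rw [sub_eq_iff_eq_add]
  exact h.symm

theorem TDRSI_eq_drsOperator {f : X → EReal} {g : K → EReal} (hf : IsGamma0 f) (hg : IsGamma0 g)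
    (A : X →L[ℝ] K) : TDRSI f g A =
      drsOperator (sumFun f g) (indicatorFun ((checkA A).ker : Set (WithLp 2 (X × K)))) := by
  funext z
  simp only [drsOperator, Function.comp_apply, rprox]
  rw [prox_indicatorFun, prox_sumFun hf hg, starProjection_ker_checkA]
  rfl

theorem lipschitzWith_TDRSI {f : X → EReal} {g : K → EReal} (hf : IsGamma0 f) (hg : IsGamma0 g)
    (A : X →L[ℝ] K) : LipschitzWith 1 (TDRSI f g A) := by
  rw [TDRSI_eq_drsOperator hf hg]
  have h1 : LipschitzWith 1 (rprox (sumFun f g)) := by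
    refine lipschitzWith_rprox (sumFun_ne_bot hf.ne_bot hg.ne_bot) fun z => ?_
    rw [prox_sumFun hf hg]
    exact IsSubgradientAt.sumFun (hf.isSubgradientAt_prox z.fst) (hg.isSubgradientAt_prox z.snd)
  have h2 : LipschitzWith 1 (rprox (indicatorFun ((checkA A).ker : Set (WithLp 2 (X × K))))) := by
    refine lipschitzWith_rprox (indicatorFun_ne_bot _) fun z => ?_
    rw [prox_indicatorFun]
    exact isSubgradientAt_indicatorFun _ z
  simpa [drsOperator] using h1.comp h2

/-- Fixed points of the Douglas–Rachford operator in terms of subgradients. -/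
theorem mem_fixedPoints_TDRSI {f : X → EReal} {g : K → EReal} (hf : IsGamma0 f) (hg : IsGamma0 g)
    (A : X →L[ℝ] K) (z : WithLp 2 (X × K)) :
    z ∈ Function.fixedPoints (TDRSI f g A) ↔
      IsSubgradientAt (sumFun f g) ((checkA A).ker.starProjection z - z)
        ((checkA A).ker.starProjection z) := by
  rw [Function.mem_fixedPoints, Function.IsFixedPt, TDRSI_eq_drsOperator hf hg]
  simp only [drsOperator, Function.comp_apply, rprox]
  rw [prox_indicatorFun]
  set p := (checkA A).ker.starProjection z
  -- `z` is fixed iff the prox of `F` at the reflected point `2 p - z` is `p`; its residual there is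
  -- `p - z`.
  have e : (2 : ℝ) • p - z - p = p - z := by module
  have hsub : IsSubgradientAt (sumFun f g) ((2 : ℝ) • p - z - prox (sumFun f g) ((2 : ℝ) • p - z))
      (prox (sumFun f g) ((2 : ℝ) • p - z)) := by
    rw [prox_sumFun hf hg]
    exact IsSubgradientAt.sumFun (hf.isSubgradientAt_prox _) (hg.isSubgradientAt_prox _)
  constructor
  · intro h
    have h2 : prox (sumFun f g) ((2 : ℝ) • p - z) = p := by
      have h3 : (2 : ℝ) • prox (sumFun f g) ((2 : ℝ) • p - z) = (2 : ℝ) • p := by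
        rw [sub_eq_iff_eq_add] at h
        rw [h]; module
      exact smul_right_injective _ (two_ne_zero' ℝ) h3
    rwa [h2, e] at hsub
  · intro h
    rw [← e] at h
    rw [h.prox_eq (sumFun_ne_bot hf.ne_bot hg.ne_bot)]
    module

/-- The subgradient is normal to the graph, so the linear term vanishes when the subgradient
inequality is tested at `(x, A x)`. -/
theorem Xi_mem_solSet {f : X → EReal} {g : K → EReal} (hf : IsGamma0 f) (hg : IsGamma0 g)
    {A : X →L[ℝ] K} {z : WithLp 2 (X × K)} (hz : z ∈ Function.fixedPoints (TDRSI f g A)) :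
    Xi A z ∈ solSet f g A := by
  rw [mem_fixedPoints_TDRSI hf hg] at hz
  refine ⟨Set.mem_univ _, fun x _ => ?_⟩
  have h := hz.2 (WithLp.toLp 2 (x, A x))
  have hmem : WithLp.toLp 2 (x, A x) - (checkA A).ker.starProjection z ∈ (checkA A).ker :=
    Submodule.sub_mem _ (mem_ker_checkA.2 rfl) (Submodule.starProjection_apply_mem _ z)
  rw [← neg_sub z, inner_neg_left, Submodule.starProjection_inner_eq_zero z _ hmem, neg_zero,
    EReal.coe_zero, add_zero, starProjection_eq_Xi] at h
  exact h

end ProductSpace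

end HSDM

namespace HSDM

/-! ### Closed images of bounded closed convex sets -/

section ClosedImage

variable {E : Type*} [NormedAddCommGroup E] [InnerProductSpace ℝ E] [CompleteSpace E]

/-- A decreasing sequence of nonempty closed convex bounded sets in a Hilbert space has a common
point. -/
theorem exists_mem_forall_of_antitone_closed_convex {D : ℕ → Set E} (hanti : Antitone D)
    (hne : ∀ n, (D n).Nonempty) (hcl : ∀ n, IsClosed (D n)) (hconv : ∀ n, Convex ℝ (D n))
    (hbdd : Bornology.IsBounded (D 0)) : ∃ x, ∀ n, x ∈ D n := by
  -- Take the points of least norm: their squared norms increase and are bounded, and the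
  -- variational inequality makes the points Cauchy.
  have hv : ∀ n, ∃ v ∈ D n, ∀ w ∈ D n, ‖v‖ ^ 2 ≤ inner ℝ v w := by
    intro n
    obtain ⟨v, hvD, hv⟩ :=
      exists_norm_eq_iInf_of_complete_convex (hne n) (hcl n).isComplete (hconv n) 0
    refine ⟨v, hvD, fun w hw => ?_⟩
    have h := (norm_eq_iInf_iff_real_inner_le_zero (hconv n) hvD).1 hv w hw
    rw [zero_sub, inner_neg_left, inner_sub_right, real_inner_self_eq_norm_sq] at h
    linarith
  choose v hvD hv using hv
  obtain ⟨R, hR⟩ := hbdd.exists_norm_le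
  have hdist : ∀ n k, n ≤ k → ‖v k - v n‖ ^ 2 ≤ ‖v k‖ ^ 2 - ‖v n‖ ^ 2 := by
    intro n k hnk
    have h := hv n (v k) (hanti hnk (hvD k))
    rw [norm_sub_sq_real, real_inner_comm]
    linarith
  have hmono : Monotone fun n => ‖v n‖ ^ 2 := fun n k hnk => by
    have := hdist n k hnk
    have h0 := sq_nonneg ‖v k - v n‖
    show ‖v n‖ ^ 2 ≤ ‖v k‖ ^ 2
    linarith
  have hbd : BddAbove (Set.range fun n => ‖v n‖ ^ 2) := by
    refine ⟨R ^ 2, ?_⟩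
    rintro _ ⟨n, rfl⟩
    exact pow_le_pow_left₀ (norm_nonneg _) (hR _ (hanti (Nat.zero_le n) (hvD n))) 2
  have hc := (tendsto_atTop_ciSup hmono hbd).cauchySeq
  have hcauchy : CauchySeq v := by
    rw [Metric.cauchySeq_iff'] at hc ⊢
    intro ε hε
    obtain ⟨N, hN⟩ := hc (ε ^ 2) (by positivity)
    refine ⟨N, fun n hn => ?_⟩
    rw [dist_eq_norm]
    refine lt_of_pow_lt_pow_left₀ 2 hε.le ((hdist N n hn).trans_lt ?_)
    exact (le_abs_self _).trans_lt (hN n hn)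
  obtain ⟨x, hx⟩ := cauchySeq_tendsto_of_complete hcauchy
  refine ⟨x, fun n => (hcl n).mem_of_tendsto hx ?_⟩
  filter_upwards [eventually_ge_atTop n] with k hk
  exact hanti hk (hvD k)

/-- A closure point of the image is the image of a common point of the slices of `D` over shrinking
balls. This replaces weak compactness. -/
theorem isClosed_image_of_closed_convex_bounded {V : Type*} [NormedAddCommGroup V]
    [NormedSpace ℝ V] (B : E →L[ℝ] V) {D : Set E} (hcl : IsClosed D) (hconv : Convex ℝ D)
    (hbdd : Bornology.IsBounded D) : IsClosed (B '' D) := by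
  refine isClosed_of_closure_subset fun k hk => ?_
  set Dn : ℕ → Set E := fun n => D ∩ B ⁻¹' Metric.closedBall k (1 / ((n : ℝ) + 1)) with hDn
  have hanti : Antitone Dn := by
    intro n m hnm
    refine Set.inter_subset_inter_right _
      (Set.preimage_mono (Metric.closedBall_subset_closedBall ?_))
    gcongr
  have hne : ∀ n, (Dn n).Nonempty := by
    intro n
    obtain ⟨_, ⟨d, hd, rfl⟩, hdk⟩ :=
      Metric.mem_closure_iff.1 hk (1 / ((n : ℝ) + 1)) (by positivity)
    exact ⟨d, hd, Metric.mem_closedBall'.2 hdk.le⟩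
  obtain ⟨x, hx⟩ := exists_mem_forall_of_antitone_closed_convex hanti hne
    (fun n => hcl.inter (Metric.isClosed_closedBall.preimage B.continuous))
    (fun n => hconv.inter ((convex_closedBall k _).linear_preimage B.toLinearMap))
    (hbdd.subset Set.inter_subset_left)
  refine ⟨x, (hx 0).1, ?_⟩
  have h : ∀ n : ℕ, dist (B x) k ≤ 1 / ((n : ℝ) + 1) := fun n => (hx n).2
  exact dist_le_zero.1 (ge_of_tendsto' tendsto_one_div_add_atTop_nhds_zero_nat h)

end ClosedImage

/-! ### Existence of Lagrange multipliers -/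

section Duality

/-- A closed convex absorbing set in a Banach space is a neighbourhood of the origin. -/
theorem exists_ball_subset_of_absorbing {V : Type*} [NormedAddCommGroup V] [NormedSpace ℝ V]
    [CompleteSpace V] {W : Set V} (hcl : IsClosed W) (hconv : Convex ℝ W)
    (habs : ∀ k, ∃ ε : ℝ, 0 < ε ∧ ε • k ∈ W) : ∃ ρ > 0, Metric.ball (0 : V) ρ ⊆ W := by
  have h0 : (0 : V) ∈ W := by
    obtain ⟨ε, _, h⟩ := habs 0
    simpa using h
  have hscale : ∀ {k : V} {ε δ : ℝ}, 0 < ε → ε • k ∈ W → 0 ≤ δ → δ ≤ ε → δ • k ∈ W := by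
    intro k ε δ hε h hδ hle
    have := hconv.smul_mem_of_zero_mem h0 h (t := δ / ε) ⟨by positivity, (div_le_one hε).2 hle⟩
    rwa [smul_smul, div_mul_cancel₀ _ hε.ne'] at this
  -- Baire: the closed multiples `(n + 1) • W` cover `V`.
  obtain ⟨n, k₀, hk₀⟩ := nonempty_interior_of_iUnion_of_closed
    (f := fun n : ℕ => {k : V | (1 / ((n : ℝ) + 1)) • k ∈ W})
    (fun n => hcl.preimage (continuous_const_smul _)) (by
      refine Set.eq_univ_of_forall fun k => ?_
      obtain ⟨ε, hε, h⟩ := habs k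
      obtain ⟨n, hn⟩ := exists_nat_one_div_lt hε
      exact Set.mem_iUnion.2 ⟨n, hscale hε h (by positivity) hn.le⟩)
  obtain ⟨r, hr, hball⟩ := Metric.isOpen_iff.1 isOpen_interior k₀ hk₀
  set c : ℝ := 1 / ((n : ℝ) + 1) with hc
  have hc0 : 0 < c := by positivity
  obtain ⟨ε, hε, hneg⟩ := habs (-k₀)
  refine ⟨ε / (c + ε) * c * r, by positivity, fun x hx => ?_⟩
  -- Chosen so that `θ c = (1 - θ) ε`: mixing the ball around `c • k₀` with the point `-ε • k₀`
  -- recentres it at 0.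
  set θ : ℝ := ε / (c + ε) with hθ
  have hθ0 : 0 < θ := by positivity
  have hθ1 : θ + c / (c + ε) = 1 := by rw [hθ]; field_simp; ring
  have hθc : θ * c = c / (c + ε) * ε := by rw [hθ]; field_simp
  have hy : k₀ + (1 / (θ * c)) • x ∈ Metric.ball k₀ r := by
    rw [mem_ball_zero_iff] at hx
    rw [mem_ball_iff_norm, add_sub_cancel_left, norm_smul, Real.norm_of_nonneg (by positivity),
      one_div_mul_eq_div, div_lt_iff₀ (by positivity)]
    linarith
  have hyW : c • (k₀ + (1 / (θ * c)) • x) ∈ W :=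
    (interior_subset (hball hy) : _ ∈ {k : V | c • k ∈ W})
  have h := hconv hyW hneg hθ0.le (show 0 ≤ c / (c + ε) by positivity) hθ1
  have e : θ • c • (k₀ + (1 / (θ * c)) • x) + (c / (c + ε)) • ε • -k₀ = x := by
    rw [smul_smul, smul_smul, ← hθc, smul_add, smul_smul, mul_one_div_cancel (by positivity),
      one_smul, smul_neg]
    abel
  rwa [e] at h

variable {E K : Type*} [NormedAddCommGroup E] [InnerProductSpace ℝ E] [CompleteSpace E]
  [NormedAddCommGroup K] [InnerProductSpace ℝ K] [CompleteSpace K]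

/-- Existence of a Lagrange multiplier for the problem of minimizing `F` over the kernel of `B`,
when the cone generated by `B (dom F)` is a closed subspace. -/
theorem IsGamma0.exists_multiplier {F : E → EReal} (hF : IsGamma0 F) (B : E →L[ℝ] K)
    (hcone : conicalHull (B '' effDom F) = closure (Submodule.span ℝ (B '' effDom F) : Set K))
    {z₀ : E} {m : ℝ} (hz₀ : F z₀ = m) (hBz₀ : B z₀ = 0) (hmin : ∀ z, B z = 0 → (m : EReal) ≤ F z) :
    ∃ v : K, ∀ z, ((m + inner ℝ v (B z) : ℝ) : EReal) ≤ F z := by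
  -- `B (dom F)` need not span a dense subspace of `K`; interiors and separation are taken relative
  -- to `V`.
  set V : Submodule ℝ K := (Submodule.span ℝ (B '' effDom F)).topologicalClosure with hV
  have : CompleteSpace V := (Submodule.isClosed_topologicalClosure _).completeSpace_coe
  have hmemV : ∀ {z}, F z < ⊤ → B z ∈ V := fun {z} hz =>
    Submodule.le_topologicalClosure _ (Submodule.subset_span ⟨z, hz, rfl⟩)
  -- The ball supplies the boundedness that makes `B '' D` closed.
  set D : Set E := {z | F z ≤ ((m + 1 : ℝ) : EReal)} ∩ Metric.closedBall z₀ 1 with hD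
  have hDcl : IsClosed D :=
    (hF.lsc.isClosed_preimage ((m + 1 : ℝ) : EReal)).inter Metric.isClosed_closedBall
  have hDconv : Convex ℝ D := by
    refine Convex.inter ?_ (convex_closedBall _ _)
    intro x hx y hy a b ha hb hab
    have hb' : b = 1 - a := by linarith
    subst hb'
    have h := hF.combo_le hx hy ha (by linarith)
    exact h.trans (EReal.coe_le_coe_iff.2 (by linarith))
  have hDbdd : Bornology.IsBounded D := Metric.isBounded_closedBall.subset Set.inter_subset_right
  set W : Set V := Subtype.val ⁻¹' (B '' D) with hW
  have hWcl : IsClosed W :=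
    (isClosed_image_of_closed_convex_bounded B hDcl hDconv hDbdd).preimage continuous_subtype_val
  have hWconv : Convex ℝ W :=
    (hDconv.linear_image B.toLinearMap).linear_preimage V.subtype
  have habs : ∀ k : V, ∃ ε : ℝ, 0 < ε ∧ ε • k ∈ W := by
    intro k
    have hk : (k : K) ∈ conicalHull (B '' effDom F) := by
      rw [hcone]; exact k.2
    obtain ⟨t, ht, _, ⟨z, hz, rfl⟩, hkz⟩ := hk
    obtain ⟨b, hb⟩ := exists_real_eq (hF.ne_bot z) hz
    -- Small enough that moving from `z₀` towards `z` by the fraction `s` raises the value by at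
    -- most 1 and stays in the unit ball.
    set s : ℝ := 1 / (1 + |b - m| + ‖z - z₀‖) with hs
    have hden : 0 < 1 + |b - m| + ‖z - z₀‖ := by positivity
    have hs0 : 0 < s := by positivity
    have hs1 : s * (1 + |b - m| + ‖z - z₀‖) = 1 := by rw [hs]; field_simp
    have hsb : s * |b - m| ≤ 1 := by nlinarith [norm_nonneg (z - z₀), abs_nonneg (b - m)]
    have hsz : s * ‖z - z₀‖ ≤ 1 := by nlinarith [norm_nonneg (z - z₀), abs_nonneg (b - m)]
    have hsle : s ≤ 1 := by nlinarith [norm_nonneg (z - z₀), abs_nonneg (b - m)]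
    refine ⟨s / t, by positivity, s • z + (1 - s) • z₀, ⟨?_, ?_⟩, ?_⟩
    · refine (hF.combo_le hb.le hz₀.le hs0.le hsle).trans (EReal.coe_le_coe_iff.2 ?_)
      nlinarith [le_abs_self (b - m)]
    · have e : s • z + (1 - s) • z₀ - z₀ = s • (z - z₀) := by module
      rw [mem_closedBall_iff_norm, e, norm_smul, Real.norm_of_nonneg hs0.le]
      exact hsz
    · rw [map_add, map_smul, map_smul, hBz₀, smul_zero, add_zero, Submodule.coe_smul, hkz,
        smul_smul, div_mul_cancel₀ _ ht.ne']
  obtain ⟨ρ, hρ, hball⟩ := exists_ball_subset_of_absorbing hWcl hWconv habs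
  -- `P` is an epigraph-type set for the perturbed problems `B z = k`. A hyperplane supporting it at
  -- `(0, m)` gives the multiplier.
  set P : Set (V × ℝ) := {q | ∃ z, B z = q.1 ∧ F z ≤ (q.2 : EReal)} with hP
  have hPconv : Convex ℝ P := by
    rintro ⟨k, r⟩ ⟨z, hz, hzr⟩ ⟨k', r'⟩ ⟨z', hz', hzr'⟩ a b ha hb hab
    have hb' : b = 1 - a := by linarith
    subst hb'
    refine ⟨a • z + (1 - a) • z', ?_, hF.combo_le hzr hzr' ha (by linarith)⟩
    simp only at hz hz'
    simp [hz, hz']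
  have hint : ((0 : V), m + 2) ∈ interior P := by
    have hopen : IsOpen (Metric.ball (0 : V) ρ ×ˢ Set.Ioi (m + 1)) :=
      Metric.isOpen_ball.prod isOpen_Ioi
    refine interior_maximal ?_ hopen ⟨Metric.mem_ball_self hρ, ?_⟩
    · rintro ⟨k, r⟩ ⟨hk, hr⟩
      obtain ⟨z, hz, hzk⟩ := hball hk
      exact ⟨z, hzk, hz.1.trans (EReal.coe_le_coe_iff.2 (le_of_lt hr))⟩
    · show m + 1 < m + 2
      linarith
  have hnot : ((0 : V), m) ∉ interior P := by
    intro h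
    obtain ⟨δ, hδ, hsub⟩ := Metric.isOpen_iff.1 isOpen_interior _ h
    have hmem : ((0 : V), m - δ / 2) ∈ Metric.ball ((0 : V), m) δ := by
      rw [Metric.mem_ball, Prod.dist_eq, dist_self, Real.dist_eq, sub_sub_cancel_left, abs_neg,
        abs_of_pos (by positivity)]
      exact max_lt hδ (by linarith)
    obtain ⟨z, hz, hzr⟩ := interior_subset (hsub hmem)
    have := (hmin z hz).trans hzr
    rw [EReal.coe_le_coe_iff] at this
    linarith
  obtain ⟨L, hL⟩ := geometric_hahn_banach_open_point hPconv.interior isOpen_interior hnot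
  have hLP : ∀ q ∈ P, L q ≤ L (0, m) := by
    intro q hq
    have hq' : q ∈ closure (interior P) := by
      rw [hPconv.closure_interior_eq_closure_of_nonempty_interior ⟨_, hint⟩]
      exact subset_closure hq
    exact closure_minimal (fun a ha => (hL a ha).le)
      (isClosed_le L.continuous continuous_const) hq'
  set c : ℝ := L (0, 1) with hc
  set l : V →L[ℝ] ℝ := L ∘L ContinuousLinearMap.inl ℝ V ℝ with hl
  have hLeq : ∀ (k : V) (r : ℝ), L (k, r) = l k + r * c := by
    intro k r
    have : ((k, r) : V × ℝ) = (k, 0) + r • ((0 : V), (1 : ℝ)) := by simp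
    rw [this, map_add, map_smul, smul_eq_mul]
    rfl
  -- The hyperplane is not vertical, because `(0, m + 2)` is interior to `P` directly above `(0,
  -- m)`.
  have hcneg : c < 0 := by
    have h := hL _ hint
    rw [hLeq, hLeq] at h
    linarith
  set v₀ : V := (InnerProductSpace.toDual ℝ V).symm l with hv₀
  refine ⟨(-c)⁻¹ • (v₀ : K), fun z => ?_⟩
  rcases eq_top_or_lt_top (F z) with hz | hz
  · rw [hz]; exact le_top
  obtain ⟨b, hb⟩ := exists_real_eq (hF.ne_bot z) hz
  rw [hb, EReal.coe_le_coe_iff, inner_smul_left, RCLike.conj_to_real]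
  have h := hLP (⟨B z, hmemV hz⟩, b) ⟨z, rfl, hb.le⟩
  have hin : inner ℝ (v₀ : K) (B z) = l ⟨B z, hmemV hz⟩ := by
    rw [← InnerProductSpace.toDual_symm_apply (y := l)]
    rfl
  rw [hLeq, hLeq, map_zero, zero_add, ← hin] at h
  have hc' : 0 < -c := by linarith
  rw [← le_sub_iff_add_le', inv_mul_le_iff₀ hc']
  linarith

end Duality

/-! ### Solutions as images of fixed points -/

section FixedPointCharacterization

variable {X K : Type*} [NormedAddCommGroup X] [InnerProductSpace ℝ X]
  [NormedAddCommGroup K] [InnerProductSpace ℝ K]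

theorem isGamma0_sumFun {f : X → EReal} {g : K → EReal} (hf : IsGamma0 f) (hg : IsGamma0 g) :
    IsGamma0 (sumFun f g) where
  ne_bot := sumFun_ne_bot hf.ne_bot hg.ne_bot
  proper := by
    obtain ⟨x, hx⟩ := hf.proper
    obtain ⟨y, hy⟩ := hg.proper
    exact ⟨WithLp.toLp 2 (x, y), EReal.add_lt_top (ne_of_lt hx) (ne_of_lt hy)⟩
  lsc := by
    refine LowerSemicontinuous.add' (hf.lsc.comp (WithLp.fstL 2 ℝ X K).continuous)
      (hg.lsc.comp (WithLp.sndL 2 ℝ X K).continuous) fun z => ?_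
    exact EReal.continuousAt_add (Or.inr (hg.ne_bot _)) (Or.inl (hf.ne_bot _))
  convex := by
    intro z hz w hw t ht0 ht1
    obtain ⟨hz1, hz2⟩ := (sumFun_lt_top_iff hf.ne_bot hg.ne_bot).1 hz
    obtain ⟨hw1, hw2⟩ := (sumFun_lt_top_iff hf.ne_bot hg.ne_bot).1 hw
    obtain ⟨a, ha⟩ := exists_real_eq (hf.ne_bot _) hz1
    obtain ⟨b, hb⟩ := exists_real_eq (hg.ne_bot _) hz2
    obtain ⟨a', ha'⟩ := exists_real_eq (hf.ne_bot _) hw1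
    obtain ⟨b', hb'⟩ := exists_real_eq (hg.ne_bot _) hw2
    have h := add_le_add (hf.combo_le ha.le ha'.le ht0.le ht1.le)
      (hg.combo_le hb.le hb'.le ht0.le ht1.le)
    refine h.trans ?_
    rw [sumFun, sumFun, ha, hb, ha', hb']
    simp only [← EReal.coe_add, ← EReal.coe_mul]
    rw [EReal.coe_le_coe_iff]
    linarith

/-- The sign is the one for which the `sri` hypothesis becomes the cone condition of
`IsGamma0.exists_multiplier`. -/
theorem image_neg_checkA_effDom {f : X → EReal} {g : K → EReal} (hf : IsGamma0 f)
    (hg : IsGamma0 g) (A : X →L[ℝ] K) :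
    (-checkA A) '' effDom (sumFun f g) = effDom g - A '' effDom f := by
  ext k
  simp only [Set.mem_image, Set.mem_sub]
  constructor
  · rintro ⟨z, hz, rfl⟩
    obtain ⟨h1, h2⟩ := (sumFun_lt_top_iff hf.ne_bot hg.ne_bot).1 hz
    exact ⟨z.snd, h2, A z.fst, ⟨z.fst, h1, rfl⟩, by simp [checkA]⟩
  · rintro ⟨y, hy, _, ⟨x, hx, rfl⟩, rfl⟩
    exact ⟨WithLp.toLp 2 (x, y), (sumFun_lt_top_iff hf.ne_bot hg.ne_bot).2 ⟨hx, hy⟩,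
      by simp [checkA]⟩

variable [CompleteSpace X] [CompleteSpace K]

/-- A multiplier `v` makes `u = (-A* v, v)` a subgradient of `F` at `p = (x, A x)`. Since `u` is
normal to the graph, `p - u` projects to `p` and is the required fixed point. -/
theorem exists_fixedPoint_of_mem_solSet {f : X → EReal} {g : K → EReal} (hf : IsGamma0 f)
    (hg : IsGamma0 g) {A : X →L[ℝ] K} (hqual : (0 : K) ∈ sri (effDom g - A '' effDom f))
    {x : X} (hx : x ∈ solSet f g A) :
    ∃ z ∈ Function.fixedPoints (TDRSI f g A), Xi A z = x := by
  have hF := isGamma0_sumFun hf hg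
  have hmin : ∀ w : WithLp 2 (X × K), (-checkA A) w = 0 →
      sumFun f g (WithLp.toLp 2 (x, A x)) ≤ sumFun f g w := by
    intro w hw
    have hw' : A w.fst = w.snd := mem_ker_checkA.1 (by simpa using hw)
    have h : f x + g (A x) ≤ f w.fst + g (A w.fst) := hx.2 (Set.mem_univ w.fst)
    rw [hw'] at h
    exact h
  have hlt : sumFun f g (WithLp.toLp 2 (x, A x)) < ⊤ := by
    obtain ⟨h0, -⟩ := hqual
    rw [← image_neg_checkA_effDom hf hg] at h0
    obtain ⟨w, hw, hw0⟩ := h0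
    exact (hmin w hw0).trans_lt hw
  obtain ⟨m, hm⟩ := exists_real_eq (hF.ne_bot _) hlt
  have hcone := hqual.2
  rw [Set.sub_singleton] at hcone
  simp only [sub_zero, Set.image_id'] at hcone
  rw [← image_neg_checkA_effDom hf hg] at hcone
  rw [hm] at hmin
  obtain ⟨v, hv⟩ := hF.exists_multiplier (-checkA A) hcone hm (by simp [checkA]) hmin
  set p : WithLp 2 (X × K) := WithLp.toLp 2 (x, A x) with hp
  set u : WithLp 2 (X × K) := WithLp.toLp 2 (-ContinuousLinearMap.adjoint A v, v) with hu
  have hinner : ∀ w : WithLp 2 (X × K), inner ℝ u w = inner ℝ v ((-checkA A) w) := by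
    intro w
    rw [WithLp.prod_inner_apply]
    change inner ℝ (-ContinuousLinearMap.adjoint A v) w.fst + inner ℝ v w.snd = _
    rw [inner_neg_left, ContinuousLinearMap.adjoint_inner_left]
    simp [checkA, inner_sub_right]
    ring
  have hpker : p ∈ (checkA A).ker := mem_ker_checkA.2 rfl
  have hproj : (checkA A).ker.starProjection (p - u) = p := by
    refine Submodule.eq_starProjection_of_mem_of_inner_eq_zero hpker fun w hw => ?_
    have hw0 : checkA A w = 0 := hw
    rw [sub_sub_cancel_left, inner_neg_left, hinner]
    simp [hw0]
  refine ⟨p - u, ?_, ?_⟩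
  · rw [mem_fixedPoints_TDRSI hf hg, hproj, sub_sub_cancel]
    refine ⟨hlt, fun w => ?_⟩
    have hp0 : checkA A p = 0 := hpker
    rw [hinner, hm, ← EReal.coe_add, map_sub]
    have : (-checkA A) p = 0 := by simp [hp0]
    rw [this, sub_zero]
    exact hv w
  · have h := starProjection_eq_Xi A (p - u)
    rw [hproj] at h
    exact (congrArg WithLp.fst h).symm

theorem solSet_eq_image_fixedPoints {f : X → EReal} {g : K → EReal} (hf : IsGamma0 f)
    (hg : IsGamma0 g) {A : X →L[ℝ] K} (hqual : (0 : K) ∈ sri (effDom g - A '' effDom f)) :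
    solSet f g A = Xi A '' Function.fixedPoints (TDRSI f g A) := by
  refine Set.Subset.antisymm (fun x hx => exists_fixedPoint_of_mem_solSet hf hg hqual hx) ?_
  rintro _ ⟨z, hz, rfl⟩
  exact Xi_mem_solSet hf hg hz

theorem argminOn_image {E F β : Type*} [Preorder β] (φ : F → β) (q : E → F) (S : Set E) :
    argminOn φ (q '' S) = q '' argminOn (fun z => φ (q z)) S := by
  ext x
  constructor
  · rintro ⟨⟨z, hz, rfl⟩, hmin⟩
    exact ⟨z, ⟨hz, fun w hw => hmin ⟨w, hw, rfl⟩⟩, rfl⟩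
  · rintro ⟨z, ⟨hz, hmin⟩, rfl⟩
    refine ⟨⟨z, hz, rfl⟩, ?_⟩
    rintro _ ⟨w, hw, rfl⟩
    exact hmin hw

end FixedPointCharacterization

end HSDM

namespace HSDM

/-! ### Real sequences -/

section Sequences

/-- Non-summable decrements force the sequence below `ε`. Afterwards it stays below `2 * ε`: one
step from below `ε` cannot leave, and from above `ε` it does not increase. -/
theorem tendsto_zero_of_eventually_decreasing {a : ℕ → ℝ} (ha : ∀ n, 0 ≤ a n)
    (hdec : ∀ ε > 0, ∃ s : ℕ → ℝ, (∀ n, 0 ≤ s n) ∧ ¬ Summable s ∧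
      ∀ᶠ n in atTop, ε ≤ a n → a (n + 1) ≤ a n - s n)
    (hstep : ∀ ε > 0, ∀ᶠ n in atTop, a n < ε → a (n + 1) < 2 * ε) :
    Tendsto a atTop (𝓝 0) := by
  have key : ∀ ε > 0, ∀ᶠ n in atTop, a n < 2 * ε := by
    intro ε hε
    obtain ⟨s, hs, hns, hev⟩ := hdec ε hε
    obtain ⟨N, hN⟩ := eventually_atTop.1 (hev.and (hstep ε hε))
    have hex : ∃ n ≥ N, a n < ε := by
      by_contra! hcon
      refine hns ((summable_nat_add_iff N).1 ?_)
      refine summable_of_sum_range_le (c := a N) (fun n => hs _) fun k => ?_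
      have h : ∑ i ∈ Finset.range k, s (i + N) ≤ a N - a (k + N) := by
        induction k with
        | zero => simp
        | succ k ih =>
          rw [Finset.sum_range_succ]
          have h1 := (hN (k + N) (by omega)).1 (hcon _ (by omega))
          rw [show k + 1 + N = k + N + 1 by omega]
          linarith
      linarith [ha (k + N)]
    obtain ⟨n₀, hn₀, hlt⟩ := hex
    refine eventually_atTop.2 ⟨n₀, fun n hn => ?_⟩
    induction n, hn using Nat.le_induction with
    | base => linarith
    | succ n hn ih =>
      have hNn := hN n (by omega)
      rcases lt_or_ge (a n) ε with h | h
      · exact hNn.2 h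
      · linarith [hNn.1 h, hs n]
  rw [Metric.tendsto_atTop]
  intro ε hε
  obtain ⟨N, hN⟩ := eventually_atTop.1 (key (ε / 2) (by positivity))
  refine ⟨N, fun n hn => ?_⟩
  rw [Real.dist_0_eq_abs, abs_of_nonneg (ha n)]
  linarith [hN n hn]

/-- Discrete Grönwall estimate, from `1 + b ≤ exp b`. -/
theorem exists_eventually_le_of_le_one_add_mul {E b : ℕ → ℝ} (hE : ∀ n, 0 ≤ E n)
    (hb : ∀ n, 0 ≤ b n) (hsum : Summable b)
    (h : ∀ᶠ n in atTop, E (n + 1) ≤ (1 + b n) * E n) : ∃ M, ∀ᶠ n in atTop, E n ≤ M := by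
  obtain ⟨N, hN⟩ := eventually_atTop.1 h
  have hs' := (summable_nat_add_iff N).2 hsum
  have key : ∀ k, E (k + N) ≤ E N * Real.exp (∑ i ∈ Finset.range k, b (i + N)) := by
    intro k
    induction k with
    | zero => simp
    | succ k ih =>
      rw [Finset.sum_range_succ, Real.exp_add, show k + 1 + N = k + N + 1 by omega]
      have h1 := hN (k + N) (by omega)
      have h2 : 1 + b (k + N) ≤ Real.exp (b (k + N)) := by
        linarith [Real.add_one_le_exp (b (k + N))]
      calc E (k + N + 1) ≤ (1 + b (k + N)) * E (k + N) := h1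
        _ ≤ Real.exp (b (k + N)) * (E N * Real.exp (∑ i ∈ Finset.range k, b (i + N))) :=
          mul_le_mul h2 ih (hE _) (Real.exp_pos _).le
        _ = _ := by ring
  refine ⟨E N * Real.exp (∑' i, b (i + N)), eventually_atTop.2 ⟨N, fun n hn => ?_⟩⟩
  obtain ⟨k, rfl⟩ := Nat.exists_eq_add_of_le' hn
  refine (key k).trans (mul_le_mul_of_nonneg_left (Real.exp_le_exp.2 ?_) (hE N))
  exact hs'.sum_le_tsum _ fun i _ => hb _

theorem tendsto_zero_of_summable_sq {a : ℕ → ℝ} (ha : ∀ n, 0 ≤ a n)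
    (h : Summable fun n => a n ^ 2) : Tendsto a atTop (𝓝 0) := by
  have h1 := (Real.continuous_sqrt.tendsto 0).comp h.tendsto_atTop_zero
  rw [Real.sqrt_zero] at h1
  exact h1.congr fun n => Real.sqrt_sq (ha n)

end Sequences

/-! ### Relaxed nonexpansive maps -/

section Relaxation

variable {H : Type*} [NormedAddCommGroup H] [InnerProductSpace ℝ H]

theorem fixedPoints_relaxed {α : ℝ} (hα : α ≠ 0) (T : H → H) :
    Function.fixedPoints (relaxed α T) = Function.fixedPoints T := by
  ext z
  simp only [Function.mem_fixedPoints, Function.IsFixedPt, relaxed]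
  have e : (1 - α) • z + α • T z = z + α • (T z - z) := by module
  rw [e, add_eq_left, smul_eq_zero, sub_eq_zero, or_iff_right hα]

/-- The last term is the source of strict attraction when `0 < α < 1`. -/
theorem norm_sq_relaxed_sub (α : ℝ) (T : H → H) (z w : H) :
    ‖relaxed α T z - w‖ ^ 2 =
      (1 - α) * ‖z - w‖ ^ 2 + α * ‖T z - w‖ ^ 2 - α * (1 - α) * ‖T z - z‖ ^ 2 := by
  have e1 : relaxed α T z - w = (1 - α) • (z - w) + α • (T z - w) := by
    simp only [relaxed]; module
  have e2 : T z - z = (T z - w) - (z - w) := by abel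
  rw [e1, e2, norm_add_sq_real, norm_sub_sq_real (T z - w) (z - w), norm_smul, norm_smul, mul_pow,
    mul_pow, Real.norm_eq_abs, Real.norm_eq_abs, sq_abs, sq_abs, inner_smul_left, inner_smul_right,
    real_inner_comm (T z - w) (z - w)]
  simp only [RCLike.conj_to_real]
  ring

theorem isAttractingNonexpansive_relaxed {α : ℝ} (h0 : 0 < α) (h1 : α < 1) {T : H → H}
    (hT : LipschitzWith 1 T) (hne : (Function.fixedPoints T).Nonempty) :
    IsAttractingNonexpansive (relaxed α T) := by
  have hT' : ∀ x y, ‖T x - T y‖ ≤ ‖x - y‖ := fun x y => by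
    simpa [dist_eq_norm] using hT.dist_le_mul x y
  rw [IsAttractingNonexpansive, fixedPoints_relaxed h0.ne']
  refine ⟨?_, hne, ?_⟩
  · refine LipschitzWith.of_dist_le_mul fun x y => ?_
    rw [NNReal.coe_one, one_mul, dist_eq_norm, dist_eq_norm]
    have e : relaxed α T x - relaxed α T y = (1 - α) • (x - y) + α • (T x - T y) := by
      simp only [relaxed]; module
    rw [e]
    refine (norm_add_le _ _).trans ?_
    rw [norm_smul, norm_smul, Real.norm_of_nonneg h0.le, Real.norm_of_nonneg (by linarith)]
    nlinarith [hT' x y]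
  · intro z hz w hw
    have hw' : T w = w := hw
    have hTz : 0 < ‖T z - z‖ := norm_pos_iff.2 (sub_ne_zero.2 hz)
    have hle : ‖T z - w‖ ≤ ‖z - w‖ := by simpa [hw'] using hT' z w
    have hsq : ‖T z - w‖ ^ 2 ≤ ‖z - w‖ ^ 2 := pow_le_pow_left₀ (norm_nonneg _) hle 2
    refine lt_of_pow_lt_pow_left₀ 2 (norm_nonneg _) ?_
    rw [norm_sq_relaxed_sub]
    have h2 : 0 < α * (1 - α) * ‖T z - z‖ ^ 2 := by
      have : 0 < 1 - α := by linarith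
      positivity
    nlinarith

end Relaxation

/-! ### Gradients of convex functions -/

section Gradients

variable {H : Type*} [NormedAddCommGroup H] [InnerProductSpace ℝ H]

theorem IsGamma0.add_inner_le {Θ : H → ℝ} (hΘ : IsGamma0 fun x => (Θ x : EReal)) {a x : H}
    (ha : HasGateauxGradientAt Θ a x) (y : H) : Θ x + inner ℝ a (y - x) ≤ Θ y := by
  have hd : HasDerivAt (fun t : ℝ => Θ (x + t • (y - x))) (inner ℝ a (y - x)) 0 := ha (y - x)
  have hlim := hd.tendsto_slope_zero_right
  have hle : inner ℝ a (y - x) ≤ Θ y - Θ x := by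
    refine le_of_tendsto hlim ?_
    filter_upwards [Ioo_mem_nhdsGT (zero_lt_one' ℝ)] with t ht
    have h := hΘ.combo_le (x := y) (y := x) le_rfl le_rfl ht.1.le ht.2.le
    rw [EReal.coe_le_coe_iff] at h
    have e : t • y + (1 - t) • x = x + t • (y - x) := by module
    rw [e] at h
    rw [zero_add, zero_smul, add_zero, smul_eq_mul, inv_mul_le_iff₀ ht.1]
    linarith
  linarith

theorem IsGamma0.lowerSemicontinuous_real {Θ : H → ℝ} (hΘ : IsGamma0 fun x => (Θ x : EReal)) :
    LowerSemicontinuous Θ := by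
  intro x y hy
  filter_upwards [hΘ.lsc x y (EReal.coe_lt_coe_iff.2 hy)] with w hw
  exact EReal.coe_lt_coe_iff.1 hw

theorem IsGamma0.comp_clm {E : Type*} [NormedAddCommGroup E] [InnerProductSpace ℝ E]
    {Ψ : H → ℝ} (hΨ : IsGamma0 fun x => (Ψ x : EReal)) (L : E →L[ℝ] H) :
    IsGamma0 fun z => (Ψ (L z) : EReal) where
  ne_bot z := EReal.coe_ne_bot _
  proper := ⟨0, EReal.coe_lt_top _⟩
  lsc := hΨ.lsc.comp L.continuous
  convex x _ y _ t ht0 ht1 := by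
    simp only [map_add, map_smul]
    exact hΨ.convex (L x) (EReal.coe_lt_top _) (L y) (EReal.coe_lt_top _) t ht0 ht1

theorem HasGateauxGradientAt.comp_clm {E : Type*} [NormedAddCommGroup E] [InnerProductSpace ℝ E]
    [CompleteSpace H] [CompleteSpace E] {Ψ : H → ℝ} (L : E →L[ℝ] H) {a : H} {z : E}
    (h : HasGateauxGradientAt Ψ a (L z)) :
    HasGateauxGradientAt (fun z => Ψ (L z)) (ContinuousLinearMap.adjoint L a) z := by
  intro w
  rw [ContinuousLinearMap.adjoint_inner_left]
  have := h (L w)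
  rw [HasLineDerivAt] at this ⊢
  simpa only [map_add, map_smul] using this

end Gradients

end HSDM

namespace HSDM

/-! ### Convergence of hybrid steepest descent -/

section Convergence

theorem isCompact_setOf_infDist_le {H : Type*} [PseudoMetricSpace H] [ProperSpace H] {F : Set H}
    (hF : IsCompact F) (hne : F.Nonempty) (r : ℝ) : IsCompact {u | Metric.infDist u F ≤ r} := by
  obtain ⟨p, hp⟩ := hne
  refine Metric.isCompact_of_isClosed_isBounded
    (isClosed_le (Metric.continuous_infDist_pt F) continuous_const) ?_
  refine (Metric.isBounded_closedBall (x := p) (r := r + Metric.diam F)).subset fun u hu => ?_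
  have h := Metric.dist_le_infDist_add_diam (x := u) hF.isBounded hp
  exact h.trans (add_le_add_left hu _)

theorem infDist_map_le_of_subset_fixedPoints {H : Type*} [PseudoMetricSpace H] {S : H → H}
    (hlip : LipschitzWith 1 S) {O : Set H} (hO : IsCompact O)
    (hne : O.Nonempty) (hsub : O ⊆ Function.fixedPoints S) (u : H) :
    Metric.infDist (S u) O ≤ Metric.infDist u O := by
  obtain ⟨p, hp, hup⟩ := hO.exists_infDist_eq_dist hne u
  have h1 : dist (S u) (S p) ≤ dist u p := by simpa using hlip.dist_le_mul u p
  rw [show S p = p from hsub hp] at h1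
  exact (Metric.infDist_le_dist_of_mem hp).trans (h1.trans hup.ge)

variable {H : Type*} [NormedAddCommGroup H] [InnerProductSpace ℝ H]

/-- A nonexpansive attracting mapping with compact fixed point set is quasi-shrinking. -/
theorem IsAttractingNonexpansive.exists_infDist_le_sub [ProperSpace H] {S : H → H}
    (hS : IsAttractingNonexpansive S) (hF : IsCompact (Function.fixedPoints S)) {r : ℝ}
    (hr : 0 < r) : ∃ D > 0, ∀ u, r ≤ Metric.infDist u (Function.fixedPoints S) →
      Metric.infDist (S u) (Function.fixedPoints S) ≤
        Metric.infDist u (Function.fixedPoints S) - D := by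
  obtain ⟨hlip, hne, hattr⟩ := hS
  set F := Function.fixedPoints S with hFdef
  set C : Set H := {u | Metric.infDist u F = r} with hC
  have hCcomp : IsCompact C := by
    refine (isCompact_setOf_infDist_le hF hne r).of_isClosed_subset
      (isClosed_eq (Metric.continuous_infDist_pt F) continuous_const) fun u hu => ?_
    exact le_of_eq hu
  have hstrict : ∀ u ∈ C, 0 < Metric.infDist u F - Metric.infDist (S u) F := by
    intro u hu
    obtain ⟨p, hp, hup⟩ := hF.exists_infDist_eq_dist hne u
    have hu' : u ∉ F := by
      intro h
      have h0 := Metric.infDist_zero_of_mem h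
      have h1 : Metric.infDist u F = r := hu
      linarith
    have h := hattr u hu' p hp
    rw [← dist_eq_norm, ← dist_eq_norm] at h
    have h1 := Metric.infDist_le_dist_of_mem (x := S u) hp
    linarith
  have hD : ∃ D > 0, ∀ u ∈ C, D ≤ Metric.infDist u F - Metric.infDist (S u) F := by
    rcases C.eq_empty_or_nonempty with h | h
    · exact ⟨1, one_pos, fun u hu => by simp [h] at hu⟩
    · have hcont : Continuous fun u => Metric.infDist u F - Metric.infDist (S u) F :=
        (Metric.continuous_infDist_pt F).sub
          ((Metric.continuous_infDist_pt F).comp hlip.continuous)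
      obtain ⟨u₀, hu₀, hmin⟩ := hCcomp.exists_isMinOn h hcont.continuousOn
      exact ⟨_, hstrict u₀ hu₀, fun u hu => hmin hu⟩
  obtain ⟨D, hD0, hD⟩ := hD
  refine ⟨D, hD0, fun u hu => ?_⟩
  obtain ⟨p, hp, hup⟩ := hF.exists_infDist_eq_dist hne u
  rw [dist_eq_norm] at hup
  have hpos : 0 < ‖u - p‖ := by linarith
  -- The point `u'` lies on the segment from `p` to `u` at distance exactly `r` from the fixed point
  -- set. The decrease `D` at `u'` passes to `u` because `S` is nonexpansive.
  set t : ℝ := r / ‖u - p‖ with ht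
  have ht0 : 0 ≤ t := by positivity
  have ht1 : t ≤ 1 := by rw [ht, div_le_one hpos]; linarith
  have htn : t * ‖u - p‖ = r := by rw [ht]; field_simp
  set u' : H := p + t • (u - p) with hu'
  have hd1 : dist u u' = Metric.infDist u F - r := by
    have e : u - u' = (1 - t) • (u - p) := by rw [hu']; module
    rw [dist_eq_norm, e, norm_smul, Real.norm_of_nonneg (by linarith), hup]
    linarith
  have hd2 : dist u' p = r := by
    have e : u' - p = t • (u - p) := by rw [hu']; abel
    rw [dist_eq_norm, e, norm_smul, Real.norm_of_nonneg ht0, htn]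
  have hmem : u' ∈ C := by
    refine le_antisymm ((Metric.infDist_le_dist_of_mem hp).trans hd2.le) ?_
    have := Metric.infDist_le_infDist_add_dist (s := F) (x := u) (y := u')
    linarith
  have h1 := hD u' hmem
  have h2 : Metric.infDist u' F = r := hmem
  have h3 := Metric.infDist_le_infDist_add_dist (s := F) (x := S u) (y := S u')
  have h4 : dist (S u) (S u') ≤ dist u u' := by simpa using hlip.dist_le_mul u u'
  linarith

theorem norm_sq_gradient_step (l : ℝ) (w a p : H) :
    ‖w - l • a - p‖ ^ 2 = ‖w - p‖ ^ 2 + 2 * l * inner ℝ a (p - w) + l ^ 2 * ‖a‖ ^ 2 := by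
  have e : w - l • a - p = (w - p) - l • a := by abel
  rw [e, norm_sub_sq_real, norm_smul, mul_pow, Real.norm_eq_abs, sq_abs, inner_smul_right,
    real_inner_comm, ← neg_sub w p, inner_neg_right]
  ring

/-- The scalar estimate for one step of the hybrid steepest descent method: `d`, `dv` and `e` are
the distances to the fixed point set before the gradient step, after it, and after applying the
mapping. -/
theorem max_sq_le_of_shrinking {d dv e l c L D : ℝ} (hl0 : 0 ≤ l) (hc0 : 0 ≤ c) (hL0 : 0 ≤ L)
    (hd0 : 0 ≤ d) (hnext0 : 0 ≤ e) (hD0 : 0 < D) (hn1 : l * (c + L) ≤ 1 / 2)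
    (hn2 : 4 * (l * c) ≤ D)
    (hstep : dv ^ 2 ≤ d ^ 2 + 2 * l * (c * d) + (l * (c + L * d)) ^ 2)
    (hdist : d ≤ dv + l * (c + L * d)) (hmap : e ≤ dv) (hD : 1 ≤ dv → e ≤ dv - D) :
    max (e ^ 2) 7 ≤ (1 + (2 * L ^ 2 + 2 * c ^ 2) * l ^ 2) * max (d ^ 2) 7 := by
  have hmax7 : 7 ≤ max (d ^ 2) 7 := le_max_right _ _
  have hfac : 1 ≤ 1 + (2 * L ^ 2 + 2 * c ^ 2) * l ^ 2 := by
    have : 0 ≤ (2 * L ^ 2 + 2 * c ^ 2) * l ^ 2 := by positivity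
    linarith
  have h7 : 7 ≤ (1 + (2 * L ^ 2 + 2 * c ^ 2) * l ^ 2) * max (d ^ 2) 7 := by nlinarith
  refine max_le ?_ h7
  -- For `d < 2`, `dv ^ 2 ≤ 4 + 2 + 1`, whence the constant 7. For `d ≥ 2` the gradient step moves
  -- by at most `d / 2`, so `dv ≥ 1` and the shrinkage absorbs the term linear in `l`; only order `l
  -- ^ 2` remains.
  rcases lt_or_ge d 2 with h2 | h2
  · refine le_trans ?_ h7
    have h3 : e ^ 2 ≤ dv ^ 2 := pow_le_pow_left₀ hnext0 hmap 2
    have h4 : l * (c + L * d) ≤ 1 := by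
      have : L * d ≤ L * 2 := mul_le_mul_of_nonneg_left h2.le hL0
      nlinarith [mul_nonneg hl0 hc0]
    have h5 : (l * (c + L * d)) ^ 2 ≤ 1 :=
      pow_le_one₀ (by positivity) h4
    have h6 : l * c ≤ 1 / 2 := by nlinarith [mul_nonneg hl0 hL0]
    have h8 : 2 * l * (c * d) ≤ 2 := by nlinarith [mul_nonneg hl0 hc0]
    have h9 : d ^ 2 ≤ 2 ^ 2 := pow_le_pow_left₀ hd0 h2.le 2
    linarith
  · have h3 : l * (c + L * d) ≤ d / 2 := by
      have : c + L * d ≤ (c + L) * d := by nlinarith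
      nlinarith [mul_le_mul_of_nonneg_left this hl0]
    have h4 : d / 2 ≤ dv := by linarith
    have h5 := hD (by linarith)
    have hDle : D ≤ dv := by linarith
    have h6 : e ^ 2 ≤ dv ^ 2 - D * dv := by
      have h13 := pow_le_pow_left₀ hnext0 h5 2
      have h14 : D * D ≤ D * dv := mul_le_mul_of_nonneg_left hDle hD0.le
      linarith [show (dv - D) ^ 2 = dv ^ 2 - 2 * (D * dv) + D * D by ring]
    have h8 : 2 * l * (c * d) ≤ D * dv := by
      have h9 : D * (d / 2) ≤ D * dv := mul_le_mul_of_nonneg_left h4 hD0.le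
      have h13 : 4 * (l * c) * d ≤ D * d := mul_le_mul_of_nonneg_right hn2 hd0
      linarith
    have h9 : (l * (c + L * d)) ^ 2 ≤ 2 * L ^ 2 * l ^ 2 * d ^ 2 + 2 * c ^ 2 * l ^ 2 := by
      nlinarith [sq_nonneg (l * (c - L * d))]
    have h10 : d ^ 2 ≤ max (d ^ 2) 7 := le_max_left _ _
    have h11 : 2 * L ^ 2 * l ^ 2 * d ^ 2 ≤ 2 * L ^ 2 * l ^ 2 * max (d ^ 2) 7 :=
      mul_le_mul_of_nonneg_left h10 (by positivity)
    have h12 : 2 * c ^ 2 * l ^ 2 * 1 ≤ 2 * c ^ 2 * l ^ 2 * max (d ^ 2) 7 :=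
      mul_le_mul_of_nonneg_left (by linarith) (by positivity)
    linarith

section

variable {S : H → H} {Θ : H → ℝ} {g : H → H} {κ : NNReal} {lam : ℕ → ℝ} {w : ℕ → H}

/-- The iterates of the hybrid steepest descent method stay at bounded distance from the fixed
point set. -/
theorem exists_eventually_infDist_le [ProperSpace H] (hS : IsAttractingNonexpansive S)
    (hF : IsCompact (Function.fixedPoints S))
    (hgrad : ∀ x y, Θ x + inner ℝ (g x) (y - x) ≤ Θ y) (hg : LipschitzWith κ g)
    (hlam : ∀ n, 0 ≤ lam n) (hsq : Summable fun n => lam n ^ 2)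
    (hw : ∀ n, w (n + 1) = S (w n - lam n • g (w n))) {c : ℝ} (hc0 : 0 ≤ c)
    (hc : ∀ p ∈ Function.fixedPoints S, ‖g p‖ ≤ c) :
    ∃ M, 0 ≤ M ∧ ∀ᶠ n in atTop, Metric.infDist (w n) (Function.fixedPoints S) ≤ M := by
  obtain ⟨D, hD0, hD⟩ := hS.exists_infDist_le_sub hF one_pos
  have hne := hS.2.1
  have hmap := infDist_map_le_of_subset_fixedPoints hS.1 hF hne subset_rfl
  set F := Function.fixedPoints S with hFdef
  set L : ℝ := (κ : ℝ) with hL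
  have hL0 : 0 ≤ L := κ.2
  have hlim := tendsto_zero_of_summable_sq hlam hsq
  have hsmall : ∀ᶠ n in atTop, lam n * (c + L) ≤ 1 / 2 ∧ 4 * (lam n * c) ≤ D := by
    have h1 : Tendsto (fun n => lam n * (c + L)) atTop (𝓝 (0 * (c + L))) := hlim.mul_const _
    have h2 : Tendsto (fun n => 4 * (lam n * c)) atTop (𝓝 (4 * (0 * c))) :=
      (hlim.mul_const _).const_mul 4
    rw [zero_mul] at h1 h2
    rw [mul_zero] at h2
    exact (h1.eventually_le_const (by norm_num)).and (h2.eventually_le_const hD0)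
  have hrec : ∀ᶠ n in atTop, max (Metric.infDist (w (n + 1)) F ^ 2) 7 ≤
      (1 + (2 * L ^ 2 + 2 * c ^ 2) * lam n ^ 2) * max (Metric.infDist (w n) F ^ 2) 7 := by
    filter_upwards [hsmall] with n hn
    obtain ⟨hn1, hn2⟩ := hn
    set l := lam n with hl
    have hl0 : 0 ≤ l := hlam n
    obtain ⟨p, hp, hwp⟩ := hF.exists_infDist_eq_dist hne (w n)
    rw [dist_eq_norm] at hwp
    set d := Metric.infDist (w n) F with hd
    have hd0 : 0 ≤ d := Metric.infDist_nonneg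
    set v := w n - l • g (w n) with hv
    set dv := Metric.infDist v F with hdv
    have hdv0 : 0 ≤ dv := Metric.infDist_nonneg
    have hgw : ‖g (w n)‖ ≤ c + L * d := by
      have h1 : ‖g (w n) - g p‖ ≤ L * ‖w n - p‖ := by
        simpa [dist_eq_norm] using hg.dist_le_mul (w n) p
      have h2 := norm_le_norm_add_norm_sub (g p) (g (w n))
      have h3 := hc p hp
      rw [hwp]
      rw [norm_sub_rev] at h2
      linarith [norm_sub_rev (g (w n)) (g p)]
    -- Monotonicity of the gradient replaces `g (w n)` by `g p`, which is bounded on the fixed point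
    -- set.
    have hin : inner ℝ (g (w n)) (p - w n) ≤ c * d := by
      have h1 := hgrad (w n) p
      have h2 := hgrad p (w n)
      have h3 := abs_le.1 (abs_real_inner_le_norm (g p) (w n - p))
      have h4 : ‖g p‖ * ‖w n - p‖ ≤ c * d := by
        rw [hwp]; exact mul_le_mul_of_nonneg_right (hc p hp) (norm_nonneg _)
      linarith
    have hstep : dv ^ 2 ≤ d ^ 2 + 2 * l * (c * d) + (l * (c + L * d)) ^ 2 := by
      have h1 : dv ≤ ‖v - p‖ := by
        rw [← dist_eq_norm]; exact Metric.infDist_le_dist_of_mem hp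
      have h2 : dv ^ 2 ≤ ‖v - p‖ ^ 2 := pow_le_pow_left₀ hdv0 h1 2
      rw [hv, norm_sq_gradient_step, ← hwp] at h2
      have h3 : ‖g (w n)‖ ^ 2 ≤ (c + L * d) ^ 2 := pow_le_pow_left₀ (norm_nonneg _) hgw 2
      have h4 := mul_le_mul_of_nonneg_left hin (show 0 ≤ 2 * l by positivity)
      have h5 := mul_le_mul_of_nonneg_left h3 (sq_nonneg l)
      rw [mul_pow]
      linarith
    have hdist : d ≤ dv + l * (c + L * d) := by
      have h1 := Metric.infDist_le_infDist_add_dist (s := F) (x := w n) (y := v)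
      have h2 : dist (w n) v = l * ‖g (w n)‖ := by
        rw [dist_eq_norm, hv, sub_sub_cancel, norm_smul, Real.norm_of_nonneg hl0]
      have h3 := mul_le_mul_of_nonneg_left hgw hl0
      linarith
    have hnext0 : 0 ≤ Metric.infDist (w (n + 1)) F := Metric.infDist_nonneg
    rw [hw n, ← hl, ← hv] at hnext0 ⊢
    exact max_sq_le_of_shrinking hl0 hc0 hL0 hd0 hnext0 hD0 hn1 hn2 hstep hdist (hmap v) (hD v)
  obtain ⟨M, hM⟩ := exists_eventually_le_of_le_one_add_mul
    (E := fun n => max (Metric.infDist (w n) F ^ 2) 7)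
    (b := fun n => (2 * L ^ 2 + 2 * c ^ 2) * lam n ^ 2)
    (fun n => (by norm_num : (0 : ℝ) ≤ 7).trans (le_max_right _ _)) (fun n => by positivity)
    (hsq.mul_left _) hrec
  refine ⟨Real.sqrt M, Real.sqrt_nonneg _, ?_⟩
  filter_upwards [hM] with n hn
  exact Real.le_sqrt_of_sq_le ((le_max_left _ _).trans hn)

/-- Convergence of the hybrid steepest descent method for a nonexpansive attracting mapping with
compact fixed point set. -/
theorem tendsto_infDist_argminOn_fixedPoints [ProperSpace H] (hS : IsAttractingNonexpansive S)
    (hF : IsCompact (Function.fixedPoints S)) (hΘ : LowerSemicontinuous Θ)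
    (hgrad : ∀ x y, Θ x + inner ℝ (g x) (y - x) ≤ Θ y) (hg : LipschitzWith κ g)
    (hΩ : (argminOn Θ (Function.fixedPoints S)).Nonempty)
    (hlam : ∀ n, 0 ≤ lam n) (hsq : Summable fun n => lam n ^ 2) (hdiv : ¬ Summable lam)
    (hw : ∀ n, w (n + 1) = S (w n - lam n • g (w n))) :
    Tendsto (fun n => Metric.infDist (w n) (argminOn Θ (Function.fixedPoints S))) atTop (𝓝 0) := by
  have hne := hS.2.1
  obtain ⟨c, hc0, hc⟩ : ∃ c : ℝ, 0 ≤ c ∧ ∀ p ∈ Function.fixedPoints S, ‖g p‖ ≤ c := by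
    obtain ⟨c, hc⟩ := (hF.image hg.continuous).isBounded.exists_norm_le
    exact ⟨max c 0, le_max_right _ _, fun p hp =>
      (hc _ (Set.mem_image_of_mem g hp)).trans (le_max_left _ _)⟩
  obtain ⟨M, hM0, hM⟩ := exists_eventually_infDist_le hS hF hgrad hg hlam hsq hw hc0 hc
  have hmapF := infDist_map_le_of_subset_fixedPoints hS.1 hF hne subset_rfl
  have hshrink := fun (r : ℝ) (hr : 0 < r) => hS.exists_infDist_le_sub hF hr
  set F := Function.fixedPoints S with hFdef
  set O := argminOn Θ F with hO
  obtain ⟨q₀, hq₀⟩ := hΩ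
  have hOeq : O = F ∩ Θ ⁻¹' Set.Iic (Θ q₀) := by
    ext u
    refine ⟨fun hu => ⟨hu.1, hu.2 hq₀.1⟩, fun hu => ⟨hu.1, fun x hx => ?_⟩⟩
    have h : Θ q₀ ≤ Θ x := hq₀.2 hx
    exact le_trans hu.2 h
  have hOne : O.Nonempty := ⟨q₀, hq₀⟩
  have hOcomp : IsCompact O := by
    rw [hOeq]
    exact hF.inter_right (hΘ.isClosed_preimage _)
  have hmapO := infDist_map_le_of_subset_fixedPoints hS.1 hOcomp hOne fun u hu => hu.1
  set G : ℝ := c + κ * M with hG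
  have hG0 : 0 ≤ G := by positivity
  have hgw : ∀ᶠ n in atTop, ‖g (w n)‖ ≤ G := by
    filter_upwards [hM] with n hn
    obtain ⟨p, hp, hwp⟩ := hF.exists_infDist_eq_dist hne (w n)
    have h1 := hg.dist_le_mul (w n) p
    rw [dist_eq_norm, ← hwp] at h1
    have h2 := norm_le_norm_add_norm_sub (g p) (g (w n))
    have h3 : (κ : ℝ) * Metric.infDist (w n) F ≤ κ * M := mul_le_mul_of_nonneg_left hn κ.2
    linarith [hc p hp, norm_sub_rev (g (w n)) (g p)]
  have hlim := tendsto_zero_of_summable_sq hlam hsq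
  have hsmall : ∀ (b : ℝ) {ε : ℝ}, 0 < ε → ∀ᶠ n in atTop, lam n * b < ε := by
    intro b ε hε
    have h1 : Tendsto (fun n => lam n * b) atTop (𝓝 (0 * b)) := hlim.mul_const b
    rw [zero_mul] at h1
    exact h1.eventually_lt_const hε
  have hdistv : ∀ {n}, ‖g (w n)‖ ≤ G → dist (w n) (w n - lam n • g (w n)) ≤ lam n * G := by
    intro n hn
    rw [dist_eq_norm, sub_sub_cancel, norm_smul, Real.norm_of_nonneg (hlam n)]
    exact mul_le_mul_of_nonneg_left hn (hlam n)
  have hFlim : Tendsto (fun n => Metric.infDist (w n) F) atTop (𝓝 0) := by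
    refine tendsto_zero_of_eventually_decreasing (fun n => Metric.infDist_nonneg) ?_ ?_
    · intro ε hε
      -- Radius `ε / 2` leaves room for the gradient step, which moves by less than `ε / 2` and
      -- costs less than half of `D`.
      obtain ⟨D, hD0, hD⟩ := hshrink (ε / 2) (by positivity)
      refine ⟨fun _ => D / 2, fun _ => by positivity, ?_, ?_⟩
      · rw [summable_const_iff]; positivity
      · filter_upwards [hgw, hsmall G (show 0 < ε / 2 by positivity),
          hsmall G (show 0 < D / 2 by positivity)] with n h1 h2 h3 h4
        have h5 := hdistv h1
        have h6 := Metric.infDist_le_infDist_add_dist (s := F) (x := w n)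
          (y := w n - lam n • g (w n))
        have h7 := Metric.infDist_le_infDist_add_dist (s := F) (x := w n - lam n • g (w n))
          (y := w n)
        rw [dist_comm] at h7
        have h8 := hD (w n - lam n • g (w n)) (by linarith)
        rw [hw n]
        linarith
    · intro ε hε
      filter_upwards [hgw, hsmall G hε] with n h1 h2 h3
      have h5 := hdistv h1
      have h7 := Metric.infDist_le_infDist_add_dist (s := F) (x := w n - lam n • g (w n))
        (y := w n)
      rw [dist_comm] at h7
      have h8 := hmapF (w n - lam n • g (w n))
      rw [hw n]
      linarith
  have hsqlim : Tendsto (fun n => Metric.infDist (w n) O ^ 2) atTop (𝓝 0) := by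
    refine tendsto_zero_of_eventually_decreasing (fun n => sq_nonneg _) ?_ ?_
    · intro ε hε
      set C : Set H := {u | Metric.infDist u F ≤ M} ∩ {u | ε ≤ Metric.infDist u O ^ 2} with hC
      have hCcomp : IsCompact C := (isCompact_setOf_infDist_le hF hne M).inter_right
        (isClosed_le continuous_const ((Metric.continuous_infDist_pt O).pow 2))
      -- The maximum is positive off `O` and attains its minimum on the compact `C`. Since the
      -- distance to `F` tends to 0, eventually `Θ` must exceed its minimum over `F` by `η`.
      have hη : ∃ η > 0, ∀ u ∈ C, η ≤ max (Metric.infDist u F) (Θ u - Θ q₀) := by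
        rcases C.eq_empty_or_nonempty with h | h
        · exact ⟨1, one_pos, fun u hu => by simp [h] at hu⟩
        · have hlsc : LowerSemicontinuous fun u => max (Metric.infDist u F) (Θ u - Θ q₀) := by
            intro u y hy
            rcases lt_max_iff.1 hy with h | h
            · filter_upwards [(Metric.continuous_infDist_pt F).lowerSemicontinuous u y h] with x hx
              exact lt_max_of_lt_left hx
            · filter_upwards [hΘ u (y + Θ q₀) (by linarith)] with x hx
              exact lt_max_of_lt_right (by linarith)
          obtain ⟨u₀, hu₀, hmin⟩ := hlsc.lowerSemicontinuousOn C |>.exists_isMinOn h hCcomp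
          refine ⟨_, ?_, fun u hu => hmin hu⟩
          by_contra! hcon
          have h1 : Metric.infDist u₀ F ≤ 0 := (le_max_left _ _).trans hcon
          have h2 : Θ u₀ - Θ q₀ ≤ 0 := (le_max_right _ _).trans hcon
          have h3 : u₀ ∈ F := (hF.isClosed.mem_iff_infDist_zero hne).2
            (le_antisymm h1 Metric.infDist_nonneg)
          have h4 : u₀ ∈ O := by
            rw [hOeq]; exact ⟨h3, sub_nonpos.1 h2⟩
          have h5 : ε ≤ Metric.infDist u₀ O ^ 2 := hu₀.2
          rw [Metric.infDist_zero_of_mem h4] at h5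
          norm_num at h5
          linarith
      obtain ⟨η, hη0, hη⟩ := hη
      refine ⟨fun n => η * lam n, fun n => mul_nonneg hη0.le (hlam n), ?_, ?_⟩
      · rwa [summable_mul_left_iff hη0.ne']
      · filter_upwards [hM, hgw, hFlim.eventually_lt_const hη0, hsmall (G ^ 2) hη0]
          with n h1 h2 h3 h4 h5
        have h6 : η ≤ Θ (w n) - Θ q₀ := by
          rcases le_max_iff.1 (hη (w n) ⟨h1, h5⟩) with h | h
          · linarith
          · exact h
        obtain ⟨q, hq, hwq⟩ := hOcomp.exists_infDist_eq_dist hOne (w n)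
        rw [dist_eq_norm] at hwq
        have hqeq : Θ q ≤ Θ q₀ := hq.2 hq₀.1
        have h7 : Metric.infDist (w (n + 1)) O ≤ ‖w n - lam n • g (w n) - q‖ := by
          rw [hw n, ← dist_eq_norm]
          exact (hmapO _).trans (Metric.infDist_le_dist_of_mem hq)
        have h8 := pow_le_pow_left₀ Metric.infDist_nonneg h7 2
        rw [norm_sq_gradient_step, ← hwq] at h8
        have h9 : inner ℝ (g (w n)) (q - w n) ≤ -η := by
          linarith [hgrad (w n) q]
        have h10 := mul_le_mul_of_nonneg_left h9 (show 0 ≤ 2 * lam n by linarith [hlam n])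
        have h11 : ‖g (w n)‖ ^ 2 ≤ G ^ 2 := pow_le_pow_left₀ (norm_nonneg _) h2 2
        have h12 := mul_le_mul_of_nonneg_left h11 (sq_nonneg (lam n))
        have h13 := mul_le_mul_of_nonneg_left h4.le (hlam n)
        show _ ≤ _ - η * lam n
        linarith
    · intro ε hε
      -- If the squared distance is below `ε`, the distance is at most `1 + ε`; expanding its square
      -- after a step of length at most `lam n * G ≤ 1` gives this factor.
      filter_upwards [hgw, hsmall G one_pos, hsmall (G * (2 * (1 + ε) + 1)) hε]
        with n h1 h2 h3 h4
      have h5 := hdistv h1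
      have h7 := Metric.infDist_le_infDist_add_dist (s := O) (x := w n - lam n • g (w n))
        (y := w n)
      rw [dist_comm] at h7
      have h8 : Metric.infDist (w (n + 1)) O ≤ Metric.infDist (w n) O + lam n * G := by
        rw [hw n]
        linarith [hmapO (w n - lam n • g (w n))]
      have h9 := pow_le_pow_left₀ Metric.infDist_nonneg h8 2
      have he0 : 0 ≤ Metric.infDist (w n) O := Metric.infDist_nonneg
      have he : Metric.infDist (w n) O ≤ 1 + ε := by nlinarith
      have hlG : 0 ≤ lam n * G := mul_nonneg (hlam n) hG0
      have h10 : lam n * G * Metric.infDist (w n) O ≤ lam n * G * (1 + ε) :=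
        mul_le_mul_of_nonneg_left he hlG
      have h11 : (lam n * G) ^ 2 ≤ lam n * G := by nlinarith
      nlinarith
  have h := (Real.continuous_sqrt.tendsto 0).comp hsqlim
  rw [Real.sqrt_zero] at h
  exact h.congr fun n => Real.sqrt_sq Metric.infDist_nonneg

end

end Convergence

/-- The `+ 1` keeps the factor positive, so that it can be divided out. -/
theorem infDist_image_le {E F : Type*} [NormedAddCommGroup E] [InnerProductSpace ℝ E]
    [NormedAddCommGroup F] [InnerProductSpace ℝ F] (L : E →L[ℝ] F) {O : Set E} (hne : O.Nonempty)
    (z : E) : Metric.infDist (L z) (L '' O) ≤ (‖L‖ + 1) * Metric.infDist z O := by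
  have hpos : 0 < ‖L‖ + 1 := by positivity
  rw [← div_le_iff₀' hpos, Metric.le_infDist hne]
  intro q hq
  rw [div_le_iff₀' hpos]
  refine (Metric.infDist_le_dist_of_mem (Set.mem_image_of_mem L hq)).trans ?_
  rw [dist_eq_norm, dist_eq_norm, ← map_sub]
  refine (L.le_opNorm _).trans ?_
  gcongr
  linarith

end HSDM

theorem theorem1
    {X K : Type*} [NormedAddCommGroup X] [InnerProductSpace ℝ X] [CompleteSpace X]
    [NormedAddCommGroup K] [InnerProductSpace ℝ K] [CompleteSpace K]
    (f : X → EReal) (hf : IsGamma0 f) (g : K → EReal) (hg : IsGamma0 g) (A : X →L[ℝ] K)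
    (hSp : (solSet f g A).Nonempty)
    (hqual : (0 : K) ∈ sri (effDom g - A '' effDom f))
    (Ψ : X → ℝ) (hΨ : IsGamma0 (fun x => (Ψ x : EReal)))
    (G : X → X) (hG : ∀ x, HasGateauxGradientAt Ψ (G x) x)
    (hLip : ∃ κ : NNReal, LipschitzWith κ G)
    (hΩ : (argminOn Ψ (solSet f g A)).Nonempty) :
    -- the explicit operator is the Douglas–Rachford operator of `F` and the graph subspace
    TDRSI f g A = drsOperator (sumFun f g) (indicatorFun ((checkA A).ker : Set (WithLp 2 (X × K))))
    ∧ LipschitzWith 1 (TDRSI f g A)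
    -- fixed point characterizations of the two solution sets
    ∧ solSet f g A = Xi A '' Function.fixedPoints (TDRSI f g A)
    ∧ argminOn Ψ (solSet f g A) =
        Xi A '' argminOn (fun z => Ψ (Xi A z)) (Function.fixedPoints (TDRSI f g A))
    -- `Θ = Ψ ∘ Ξ` lies in `Γ₀` and has the Lipschitzian gradient `Ξ* ∘ ∇Ψ ∘ Ξ`
    ∧ IsGamma0 (fun z => ((Ψ (Xi A z) : ℝ) : EReal))
    ∧ (∀ z, HasGateauxGradientAt (fun z => Ψ (Xi A z))
        (ContinuousLinearMap.adjoint (Xi A) (G (Xi A z))) z)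
    ∧ (∃ κ : NNReal, LipschitzWith κ
        (fun z => ContinuousLinearMap.adjoint (Xi A) (G (Xi A z))))
    ∧ ∀ α : ℝ, 0 < α → α < 1 →
      IsAttractingNonexpansive (relaxed α (TDRSI f g A))
      ∧ Function.fixedPoints (relaxed α (TDRSI f g A)) = Function.fixedPoints (TDRSI f g A)
      ∧ ∀ lam : ℕ → ℝ, (∀ n, 0 ≤ lam (n + 1)) → Summable (fun n => lam (n + 1) ^ 2) →
          ¬ Summable (fun n => lam (n + 1)) →
        ∀ z₀ : WithLp 2 (X × K),
          -- the explicit iteration is the hybrid steepest descent method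
          (∀ n, iterate f g A G α lam z₀ (n + 1) =
            halfIterate f g A G α lam z₀ n - lam (n + 1) •
              ContinuousLinearMap.adjoint (Xi A) (G (Xi A (halfIterate f g A G α lam z₀ n))))
          ∧ (∀ n, xStarSucc f g A G α lam z₀ n = Xi A (halfIterate f g A G α lam z₀ n))
          -- convergence
          ∧ (FiniteDimensional ℝ (WithLp 2 (X × K)) →
              Bornology.IsBounded (Function.fixedPoints (TDRSI f g A)) →
              Tendsto (fun n => Metric.infDist (xStarSucc f g A G α lam z₀ n)
                (argminOn Ψ (solSet f g A))) atTop (𝓝 0)) := by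
  have hTlip := lipschitzWith_TDRSI hf hg A
  have hsol := solSet_eq_image_fixedPoints hf hg hqual
  have hfix : (Function.fixedPoints (TDRSI f g A)).Nonempty := by
    rw [hsol] at hSp
    exact hSp.of_image
  have hargmin : argminOn Ψ (solSet f g A) =
      Xi A '' argminOn (fun z => Ψ (Xi A z)) (Function.fixedPoints (TDRSI f g A)) := by
    rw [hsol, argminOn_image]
  have hΘ : IsGamma0 (fun z => ((Ψ (Xi A z) : ℝ) : EReal)) := hΨ.comp_clm (Xi A)
  have hΘgrad : ∀ z, HasGateauxGradientAt (fun z => Ψ (Xi A z))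
      (ContinuousLinearMap.adjoint (Xi A) (G (Xi A z))) z := fun z => (hG (Xi A z)).comp_clm (Xi A)
  obtain ⟨κ, hκ⟩ := hLip
  have hΘlip := (ContinuousLinearMap.adjoint (Xi A)).lipschitz.comp (hκ.comp (Xi A).lipschitz)
  refine ⟨TDRSI_eq_drsOperator hf hg A, hTlip, hsol, hargmin, hΘ, hΘgrad, ⟨_, hΘlip⟩, ?_⟩
  intro α hα0 hα1
  have hattr := isAttractingNonexpansive_relaxed hα0 hα1 hTlip hfix
  have hfixeq := fixedPoints_relaxed hα0.ne' (TDRSI f g A)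
  refine ⟨hattr, hfixeq, ?_⟩
  intro lam hlam hsq hdiv z₀
  have hiter : ∀ n, iterate f g A G α lam z₀ (n + 1) =
      halfIterate f g A G α lam z₀ n - lam (n + 1) •
        ContinuousLinearMap.adjoint (Xi A) (G (Xi A (halfIterate f g A G α lam z₀ n))) := by
    intro n
    rw [adjoint_Xi_apply, Xi_apply]
    rfl
  have hstar : ∀ n, xStarSucc f g A G α lam z₀ n = Xi A (halfIterate f g A G α lam z₀ n) :=
    fun n => (Xi_apply A _).symm
  refine ⟨hiter, hstar, fun hfin hbdd => ?_⟩
  have : ProperSpace (WithLp 2 (X × K)) := FiniteDimensional.proper_real _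
  have hcomp : IsCompact (Function.fixedPoints (relaxed α (TDRSI f g A))) :=
    Metric.isCompact_of_isClosed_isBounded (isClosed_fixedPoints hattr.1.continuous)
      (hfixeq ▸ hbdd)
  have hne : (argminOn (fun z => Ψ (Xi A z))
      (Function.fixedPoints (relaxed α (TDRSI f g A)))).Nonempty := by
    rw [hargmin] at hΩ
    rw [hfixeq]
    exact hΩ.of_image
  -- The half-iterates satisfy the recursion "gradient step, then map", with the step sizes shifted
  -- by one.
  have hconv := tendsto_infDist_argminOn_fixedPoints hattr hcomp hΘ.lowerSemicontinuous_real
    (fun x y => hΘ.add_inner_le (hΘgrad x) y) hΘlip hne (lam := fun n => lam (n + 1)) hlam hsq hdiv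
    (w := halfIterate f g A G α lam z₀) (fun n => congrArg (relaxed α (TDRSI f g A)) (hiter n))
  rw [hfixeq] at hne hconv
  have hlim := hconv.const_mul (‖Xi A‖ + 1)
  rw [mul_zero] at hlim
  refine squeeze_zero (fun n => Metric.infDist_nonneg) (fun n => ?_) hlim
  rw [hstar, hargmin]
  exact infDist_image_le (Xi A) hne _
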